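/- **Setting.** Let $d\ge 2$ and let $\Omega\subset\mathbb{R}^d$ be a bounded, simply connected Lipschitz domain with boundary $\Gamma$ and exterior unit normal $n$. A mesh $\mathcal{T}=\{T\}$ of $\Omega$ is a finite family of pairwise disjoint Lipschitz domains $T\subset\Omega$ with $\overline\Omega=\bigcup_{T\in\mathcal T}\overline T$; $\mathcal{S}=\{\partial T:\ T\in\mathcal{T}\}$ is its skeleton. Scalar and vector $L_2$ spaces are denoted by $L_2$ and $\mathbf{L}_2=(L_2)^d$, with norm $\|\cdot\|$ and bilinear form $(\cdot,\cdot)$ on $\Omega$. For $\omega=\Omega$ or $\omega=T$, $H^1(\omega)$ and $H(\mathrm{div},\omega)=\{\tau\in\mathbf{L}_2(\omega):\ \mathrm{div}\,\tau\in L_2(\omega)\}$ carry the norms $(\|v\|_\omega^2+\|\nabla v\|_\omega^2)^{1/2}$ and $(\|\tau\|_\omega^2+\|\mathrm{div}\,\tau\|_\omega^2)^{1/2}$, written $\|\cdot\|_1$ and $\|\cdot\|_{\mathrm{div}}$ when $\omega=\Omega$; $H^1_0(\Omega)$ is the closure of $C_c^\infty(\Omega)$ in $H^1(\Omega)$, and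 $H_0(\mathrm{div},\Omega)=\{\tau\in H(\mathrm{div},\Omega):\ \tau\cdot n=0 \text{ on }\Gamma\}$. Put $H^1(\mathcal{T})=\prod_T H^1(T)$, $H(\mathrm{div},\mathcal{T})=\prod_T H(\mathrm{div},T)$, and let $(\cdot,\cdot)_{\mathcal T}=\sum_T(\cdot,\cdot)_T$, with differential operators applied elementwise. **Traces.** Define $\mathrm{tr}^{\nabla}:H^1(\mathcal T)\to H(\mathrm{div},\mathcal T)'$ and $\mathrm{tr}^{\mathrm{div}}:H(\mathrm{div},\mathcal T)\to H^1(\mathcal T)'$ by $$\langle \mathrm{tr}^{\mathrm{div}}(\tau),v\rangle_{\mathcal S}=\langle \mathrm{tr}^{\nabla}(v),\tau\rangle_{\mathcal S}=(v,\mathrm{div}\,\tau)_{\mathcal T}+(\nabla v,\tau)_{\mathcal T}.$$ The boundary traces $v|_\Gamma$ of $v\in H^1(\Omega)$ and $(\tau\cdot n)|_\Gamma$ of $\tau\in H(\mathrm{div},\Omega)$ are defined by the same formula on the single domain $\Omega$. The skeleton trace spaces are $$H^{1/2}(\mathcal S)=\mathrm{tr}^{\nabla}(H^1(\Omega)),\quad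 H^{1/2}_0(\mathcal S)=\mathrm{tr}^{\nabla}(H^1_0(\Omega)),\quad H^{-1/2}(\mathcal S)=\mathrm{tr}^{\mathrm{div}}(H(\mathrm{div},\Omega)),\quad H^{-1/2}_0(\mathcal S)=\mathrm{tr}^{\mathrm{div}}(H_0(\mathrm{div},\Omega)),$$ with the norms $$\|\hat v\|_{1/2,\mathcal S}=\inf\{\|v\|_{1}:\ v\in H^1(\Omega),\ \mathrm{tr}^{\nabla}(v)=\hat v\},\qquad \|\hat\tau\|_{-1/2,\mathcal S}=\inf\{\|\tau\|_{\mathrm{div}}:\ \tau\in H(\mathrm{div},\Omega),\ \mathrm{tr}^{\mathrm{div}}(\tau)=\hat\tau\}.$$ **Ultraweak formulation.** Let $$\mathfrak U=\mathbf{L}_2(\Omega)\times L_2(\Omega)\times\mathbf{L}_2(\Omega)\times L_2(\Omega)\times H^{-1/2}_0(\mathcal S)\times H^{1/2}_0(\mathcal S)\times H^{-1/2}(\mathcal S)\times H^{1/2}(\mathcal S),$$ where $\|\mathfrak u\|_{\mathfrak U}$ is the square root of the sum of the squared norms of the eight components of $\mathfrak u=(u_1,u_2,u_3,u_4,\hat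 u_1,\hat u_2,\hat u_3,\hat u_4)$, and let $\mathfrak V(\mathcal T)=H(\mathrm{div},\mathcal T)\times H^1(\mathcal T)\times H(\mathrm{div},\mathcal T)\times H^1(\mathcal T)$. For $\mathfrak u\in\mathfrak U$ and $\mathfrak v=(v_1,v_2,v_3,v_4)\in\mathfrak V(\mathcal T)$ set $$\begin{aligned} b(\mathfrak u,\mathfrak v)={}&(u_1,v_1-\nabla v_4)_{\mathcal T}-(u_2,v_4+\mathrm{div}\,v_3)_{\mathcal T}-(u_3,v_3+\nabla v_2)_{\mathcal T}-(u_4,v_2+\mathrm{div}\,v_1)_{\mathcal T}\\ &+\langle\hat u_1,v_4\rangle_{\mathcal S}+\langle\hat u_2,v_3\rangle_{\mathcal S}+\langle\hat u_3,v_2\rangle_{\mathcal S}+\langle\hat u_4,v_1\rangle_{\mathcal S}.\end{aligned}$$ **Theorem.** There is a constant $C>0$, depending only on $d$ and $\Omega$, such that for every mesh $\mathcal T$ of $\Omega$ and every $f\in\mathbf{L}_2(\Omega)$ there is a unique $\mathfrak u\in\mathfrak U$ with $$b(\mathfrak u,\mathfrak v)=(f,v_1)_{\mathcal T}\qquad\text{for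 all }\mathfrak v\in\mathfrak V(\mathcal T),$$ and this solution satisfies $\|\mathfrak u\|_{\mathfrak U}\le C\|f\|$. Moreover, $u:=u_1$ solves $$(\nabla\,\mathrm{div})^2u+u=f\ \text{ in }\Omega,\qquad \mathrm{div}\,u=u\cdot n=0\ \text{ on }\Gamma,$$ in the sense that $u\in H(\mathrm{div},\Omega)$, $\mathrm{div}\,u\in H^1(\Omega)$, $\nabla\mathrm{div}\,u\in H(\mathrm{div},\Omega)$, $\mathrm{div}\,\nabla\mathrm{div}\,u\in H^1(\Omega)$, the equation holds in $\mathbf{L}_2(\Omega)$, and $(\mathrm{div}\,u)|_\Gamma=0$, $(u\cdot n)|_\Gamma=0$ as traces. -/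

import Mathlib

noncomputable section

namespace GradDiv

open MeasureTheory Set
open scoped NNReal

variable {d : ℕ}

/-! ### Domains and meshes -/

/-- A Lipschitz domain in `ℝ^d`: a bounded, connected, nonempty open set which, near each of its
boundary points and after choosing a unit direction `ν`, is the strict epigraph (in direction `ν`)
of a Lipschitz function of the component of the point orthogonal to `ν`. -/
structure IsLipschitzDomain (ω : Set (EuclideanSpace ℝ (Fin d))) : Prop where
  isOpen : IsOpen ω
  isConnected : IsConnected ω
  isBounded : Bornology.IsBounded ω
  lipschitz_boundary : ∀ x ∈ frontier ω,
    ∃ ν : EuclideanSpace ℝ (Fin d), ‖ν‖ = 1 ∧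
    ∃ (K : ℝ≥0) (γ : EuclideanSpace ℝ (Fin d) → ℝ), LipschitzWith K γ ∧
    ∃ r : ℝ, 0 < r ∧ ∀ y ∈ Metric.ball x r,
      (y ∈ ω ↔ γ (y - inner ℝ ν y • ν) < inner ℝ ν y)

/-- A (finite) mesh of `Ω` consisting of pairwise disjoint open Lipschitz elements whose closures
cover the closure of `Ω`. -/
structure Mesh (Ω : Set (EuclideanSpace ℝ (Fin d))) where
  ι : Type
  [fintype : Fintype ι]
  elem : ι → Set (EuclideanSpace ℝ (Fin d))
  elem_lipschitz : ∀ i, IsLipschitzDomain (elem i)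
  elem_subset : ∀ i, elem i ⊆ Ω
  elem_disjoint : ∀ i j, i ≠ j → Disjoint (elem i) (elem j)
  closure_eq : closure Ω = ⋃ i, closure (elem i)

attribute [instance] Mesh.fintype

/-! ### Lebesgue spaces and weak derivatives -/

/-- `L₂(ω)`, scalar fields. -/
abbrev L2 (ω : Set (EuclideanSpace ℝ (Fin d))) : Type :=
  Lp ℝ 2 (volume.restrict ω)

/-- `𝑳₂(ω)`, vector fields. -/
abbrev L2v (ω : Set (EuclideanSpace ℝ (Fin d))) : Type :=
  Lp (EuclideanSpace ℝ (Fin d)) 2 (volume.restrict ω)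

/-- Test functions: `φ ∈ C_c^∞(ω)`. -/
structure IsTestFunction (ω : Set (EuclideanSpace ℝ (Fin d)))
    (φ : EuclideanSpace ℝ (Fin d) → ℝ) : Prop where
  contDiff : ContDiff ℝ (⊤ : ℕ∞) φ
  hasCompactSupport : HasCompactSupport φ
  tsupport_subset : tsupport φ ⊆ ω

/-- `g` is the weak gradient of `v` in `ω`: `∫ v ∂_e φ = - ∫ (g · e) φ` for every direction `e`. -/
def IsWeakGrad (ω : Set (EuclideanSpace ℝ (Fin d))) (v : L2 ω) (g : L2v ω) : Prop :=
  ∀ φ, IsTestFunction ω φ → ∀ e : EuclideanSpace ℝ (Fin d),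
    ∫ x in ω, v x * fderiv ℝ φ x e = - ∫ x in ω, inner ℝ (g x) e * φ x

/-- `δ` is the weak divergence of `τ` in `ω`: `∫ τ · ∇φ = - ∫ δ φ`. -/
def IsWeakDiv (ω : Set (EuclideanSpace ℝ (Fin d))) (τ : L2v ω) (δ : L2 ω) : Prop :=
  ∀ φ, IsTestFunction ω φ →
    ∫ x in ω, fderiv ℝ φ x (τ x) = - ∫ x in ω, δ x * φ x

section Helpers

variable {ω : Set (EuclideanSpace ℝ (Fin d))} {φ : EuclideanSpace ℝ (Fin d) → ℝ}

lemma IsTestFunction.memLp (h : IsTestFunction ω φ) :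
    MemLp φ 2 (volume.restrict ω) :=
  (h.contDiff.continuous.memLp_of_hasCompactSupport h.hasCompactSupport).restrict ω

lemma IsTestFunction.memLp_fderiv (h : IsTestFunction ω φ) :
    MemLp (fderiv ℝ φ) 2 (volume.restrict ω) :=
  ((h.contDiff.continuous_fderiv (by simp)).memLp_of_hasCompactSupport
    (h.hasCompactSupport.fderiv ℝ)).restrict ω

lemma IsTestFunction.memLp_fderiv_apply (h : IsTestFunction ω φ)
    (e : EuclideanSpace ℝ (Fin d)) :
    MemLp (fun x => fderiv ℝ φ x e) 2 (volume.restrict ω) :=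
  (ContinuousLinearMap.apply ℝ ℝ e).comp_memLp' h.memLp_fderiv

lemma IsTestFunction.integrable_mul (h : IsTestFunction ω φ) (v : L2 ω) :
    Integrable (fun x => v x * φ x) (volume.restrict ω) :=
  (Lp.memLp v).integrable_mul h.memLp

lemma IsTestFunction.integrable_mul_fderiv (h : IsTestFunction ω φ) (v : L2 ω)
    (e : EuclideanSpace ℝ (Fin d)) :
    Integrable (fun x => v x * fderiv ℝ φ x e) (volume.restrict ω) :=
  (Lp.memLp v).integrable_mul (h.memLp_fderiv_apply e)

lemma IsTestFunction.integrable_inner_mul (h : IsTestFunction ω φ) (g : L2v ω)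
    (e : EuclideanSpace ℝ (Fin d)) :
    Integrable (fun x => inner ℝ (g x) e * φ x) (volume.restrict ω) :=
  ((Lp.memLp g).inner_const e).integrable_mul h.memLp

lemma IsTestFunction.integrable_fderiv (h : IsTestFunction ω φ) (τ : L2v ω) :
    Integrable (fun x => fderiv ℝ φ x (τ x)) (volume.restrict ω) := by
  have := MemLp.integrable_mul (μ := volume.restrict ω) h.memLp_fderiv.norm (Lp.memLp τ).norm
  refine this.mono' ?_ ?_
  · exact isBoundedBilinearMap_apply.continuous.comp_aestronglyMeasurable₂
      h.memLp_fderiv.1 (Lp.memLp τ).1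
  · filter_upwards with x
    exact (fderiv ℝ φ x).le_opNorm (τ x)

lemma IsTestFunction.mono {ω' : Set (EuclideanSpace ℝ (Fin d))} (h : IsTestFunction ω φ)
    (hω : ω ⊆ ω') : IsTestFunction ω' φ :=
  ⟨h.contDiff, h.hasCompactSupport, h.tsupport_subset.trans hω⟩

lemma IsWeakGrad.zero : IsWeakGrad ω 0 0 := by
  intro φ hφ e
  rw [integral_congr_ae (g := fun _ => (0 : ℝ)),
    integral_congr_ae (f := fun x => inner ℝ ((0 : L2v ω) x) e * φ x) (g := fun _ => (0 : ℝ))]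
  · simp
  · filter_upwards [Lp.coeFn_zero (EuclideanSpace ℝ (Fin d)) 2 (volume.restrict ω)] with x hx
    rw [hx]
    simp
  · filter_upwards [Lp.coeFn_zero ℝ 2 (volume.restrict ω)] with x hx
    rw [hx]
    simp

lemma IsWeakGrad.add {v v' : L2 ω} {g g' : L2v ω} (h : IsWeakGrad ω v g)
    (h' : IsWeakGrad ω v' g') : IsWeakGrad ω (v + v') (g + g') := by
  intro φ hφ e
  rw [integral_congr_ae (g := fun x => v x * fderiv ℝ φ x e + v' x * fderiv ℝ φ x e),
    integral_congr_ae (f := fun x => inner ℝ ((g + g' : L2v ω) x) e * φ x)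
      (g := fun x => inner ℝ (g x) e * φ x + inner ℝ (g' x) e * φ x),
    integral_add (hφ.integrable_mul_fderiv v e) (hφ.integrable_mul_fderiv v' e),
    integral_add (hφ.integrable_inner_mul g e) (hφ.integrable_inner_mul g' e),
    h φ hφ e, h' φ hφ e]
  · ring
  · filter_upwards [Lp.coeFn_add g g'] with x hx
    simp only [hx, Pi.add_apply, inner_add_left]
    ring
  · filter_upwards [Lp.coeFn_add v v'] with x hx
    simp only [hx, Pi.add_apply]
    ring

lemma IsWeakGrad.smul {v : L2 ω} {g : L2v ω} (c : ℝ) (h : IsWeakGrad ω v g) :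
    IsWeakGrad ω (c • v) (c • g) := by
  intro φ hφ e
  rw [integral_congr_ae (g := fun x => c * (v x * fderiv ℝ φ x e)),
    integral_congr_ae (f := fun x => inner ℝ ((c • g : L2v ω) x) e * φ x)
      (g := fun x => c * (inner ℝ (g x) e * φ x)),
    integral_const_mul, integral_const_mul, h φ hφ e]
  · ring
  · filter_upwards [Lp.coeFn_smul c g] with x hx
    simp only [hx, Pi.smul_apply, real_inner_smul_left]
    ring
  · filter_upwards [Lp.coeFn_smul c v] with x hx
    simp only [hx, Pi.smul_apply, smul_eq_mul]
    ring

lemma IsWeakDiv.zero : IsWeakDiv ω 0 0 := by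
  intro φ hφ
  rw [integral_congr_ae (g := fun _ => (0 : ℝ)),
    integral_congr_ae (f := fun x => ((0 : L2 ω) x) * φ x) (g := fun _ => (0 : ℝ))]
  · simp
  · filter_upwards [Lp.coeFn_zero ℝ 2 (volume.restrict ω)] with x hx
    rw [hx]
    simp
  · filter_upwards [Lp.coeFn_zero (EuclideanSpace ℝ (Fin d)) 2 (volume.restrict ω)] with x hx
    rw [hx]
    simp

lemma IsWeakDiv.add {τ τ' : L2v ω} {δ δ' : L2 ω} (h : IsWeakDiv ω τ δ)
    (h' : IsWeakDiv ω τ' δ') : IsWeakDiv ω (τ + τ') (δ + δ') := by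
  intro φ hφ
  rw [integral_congr_ae (g := fun x => fderiv ℝ φ x (τ x) + fderiv ℝ φ x (τ' x)),
    integral_congr_ae (f := fun x => ((δ + δ' : L2 ω) x) * φ x)
      (g := fun x => δ x * φ x + δ' x * φ x),
    integral_add (hφ.integrable_fderiv τ) (hφ.integrable_fderiv τ'),
    integral_add (hφ.integrable_mul δ) (hφ.integrable_mul δ'), h φ hφ, h' φ hφ]
  · ring
  · filter_upwards [Lp.coeFn_add δ δ'] with x hx
    simp only [hx, Pi.add_apply]
    ring
  · filter_upwards [Lp.coeFn_add τ τ'] with x hx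
    simp only [hx, Pi.add_apply, map_add]

lemma IsWeakDiv.smul {τ : L2v ω} {δ : L2 ω} (c : ℝ) (h : IsWeakDiv ω τ δ) :
    IsWeakDiv ω (c • τ) (c • δ) := by
  intro φ hφ
  rw [integral_congr_ae (g := fun x => c * (fderiv ℝ φ x (τ x))),
    integral_congr_ae (f := fun x => ((c • δ : L2 ω) x) * φ x)
      (g := fun x => c * (δ x * φ x)),
    integral_const_mul, integral_const_mul, h φ hφ]
  · ring
  · filter_upwards [Lp.coeFn_smul c δ] with x hx
    simp only [hx, Pi.smul_apply, smul_eq_mul]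
    ring
  · filter_upwards [Lp.coeFn_smul c τ] with x hx
    simp only [hx, Pi.smul_apply, map_smul, smul_eq_mul]

end Helpers

/-! ### Sobolev spaces -/

/-- `H¹(ω)`, realised as the space of pairs `(v, ∇v)` with `v ∈ L₂(ω)`, `∇v ∈ 𝑳₂(ω)`.
The inherited norm is `(‖v‖² + ‖∇v‖²)^{1/2}`. -/
def H1 (ω : Set (EuclideanSpace ℝ (Fin d))) : Submodule ℝ (WithLp 2 (L2 ω × L2v ω)) where
  carrier := {p | IsWeakGrad ω p.fst p.snd}
  zero_mem' := IsWeakGrad.zero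
  add_mem' := fun h h' => IsWeakGrad.add h h'
  smul_mem' := fun c _ h => IsWeakGrad.smul c h

/-- `H(div, ω)`, realised as the space of pairs `(τ, div τ)` with `τ ∈ 𝑳₂(ω)`, `div τ ∈ L₂(ω)`.
The inherited norm is `(‖τ‖² + ‖div τ‖²)^{1/2}`. -/
def Hdiv (ω : Set (EuclideanSpace ℝ (Fin d))) : Submodule ℝ (WithLp 2 (L2v ω × L2 ω)) where
  carrier := {p | IsWeakDiv ω p.fst p.snd}
  zero_mem' := IsWeakDiv.zero
  add_mem' := fun h h' => IsWeakDiv.add h h'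
  smul_mem' := fun c _ h => IsWeakDiv.smul c h

/-- The function underlying an element of `H¹(ω)`. -/
def fn {ω : Set (EuclideanSpace ℝ (Fin d))} : H1 ω →ₗ[ℝ] L2 ω :=
  WithLp.fstₗ 2 ℝ (L2 ω) (L2v ω) ∘ₗ (H1 ω).subtype

/-- The weak gradient of an element of `H¹(ω)`. -/
def grad {ω : Set (EuclideanSpace ℝ (Fin d))} : H1 ω →ₗ[ℝ] L2v ω :=
  WithLp.sndₗ 2 ℝ (L2 ω) (L2v ω) ∘ₗ (H1 ω).subtype

/-- The vector field underlying an element of `H(div, ω)`. -/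
def fld {ω : Set (EuclideanSpace ℝ (Fin d))} : Hdiv ω →ₗ[ℝ] L2v ω :=
  WithLp.fstₗ 2 ℝ (L2v ω) (L2 ω) ∘ₗ (Hdiv ω).subtype

/-- The weak divergence of an element of `H(div, ω)`. -/
def div {ω : Set (EuclideanSpace ℝ (Fin d))} : Hdiv ω →ₗ[ℝ] L2 ω :=
  WithLp.sndₗ 2 ℝ (L2v ω) (L2 ω) ∘ₗ (Hdiv ω).subtype

/-- The elements of `H¹(ω)` that are given by test functions. -/
def testSubmodule (ω : Set (EuclideanSpace ℝ (Fin d))) : Submodule ℝ (H1 ω) where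
  carrier := {v | ∃ φ, IsTestFunction ω φ ∧ fn v =ᵐ[volume.restrict ω] φ}
  zero_mem' := ⟨0, ⟨contDiff_const, HasCompactSupport.zero, by simp [tsupport]⟩,
    Lp.coeFn_zero _ _ _⟩
  add_mem' := by
    rintro v w ⟨φ, hφ, hv⟩ ⟨ψ, hψ, hw⟩
    exact ⟨φ + ψ, ⟨hφ.contDiff.add hψ.contDiff, hφ.hasCompactSupport.add hψ.hasCompactSupport,
      (tsupport_add φ ψ).trans (union_subset hφ.tsupport_subset hψ.tsupport_subset)⟩,
      (Lp.coeFn_add _ _).trans (hv.add hw)⟩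
  smul_mem' := by
    rintro c v ⟨φ, hφ, hv⟩
    exact ⟨c • φ, ⟨contDiff_const.smul hφ.contDiff, hφ.hasCompactSupport.smul_left,
      (closure_mono (Function.support_const_smul_subset c φ)).trans hφ.tsupport_subset⟩,
      (Lp.coeFn_smul _ _).trans (hv.const_smul c)⟩

/-- `H¹₀(ω)`, the closure of the test functions in `H¹(ω)`. -/
def H10 (ω : Set (EuclideanSpace ℝ (Fin d))) : Submodule ℝ (H1 ω) :=
  (testSubmodule ω).topologicalClosure

/-! ### Traces on the boundary of a single domain -/

/-- The trace operator `H¹(ω) → H(div, ω)'`,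
`⟨tr v, τ⟩ = (v, div τ)_ω + (∇v, τ)_ω`; it represents `v|_{∂ω}`. -/
def traceGrad (ω : Set (EuclideanSpace ℝ (Fin d))) : H1 ω →L[ℝ] StrongDual ℝ (Hdiv ω) :=
  LinearMap.mkContinuous₂
    (LinearMap.mk₂ ℝ (fun (v : H1 ω) (τ : Hdiv ω) =>
        inner ℝ (fn v) (div τ) + inner ℝ (grad v) (fld τ))
      (fun v w τ => by
        simp only [map_add, inner_add_left]; ring)
      (fun c v τ => by
        simp only [map_smul, real_inner_smul_left, smul_eq_mul]; ring)
      (fun v τ σ => by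
        simp only [map_add, inner_add_right]; ring)
      (fun c v τ => by
        simp only [map_smul, real_inner_smul_right, smul_eq_mul]; ring))
    2 (fun v τ => by
      have h1 : ‖fn v‖ ≤ ‖v‖ := WithLp.norm_fst_le _ (v : WithLp 2 (L2 ω × L2v ω))
      have h2 : ‖grad v‖ ≤ ‖v‖ := WithLp.norm_snd_le _ (v : WithLp 2 (L2 ω × L2v ω))
      have h3 : ‖fld τ‖ ≤ ‖τ‖ := WithLp.norm_fst_le _ (τ : WithLp 2 (L2v ω × L2 ω))
      have h4 : ‖div τ‖ ≤ ‖τ‖ := WithLp.norm_snd_le _ (τ : WithLp 2 (L2v ω × L2 ω))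
      have h5 := (norm_inner_le_norm (𝕜 := ℝ) (fn v) (div τ)).trans
        (mul_le_mul h1 h4 (norm_nonneg _) (norm_nonneg _))
      have h6 := (norm_inner_le_norm (𝕜 := ℝ) (grad v) (fld τ)).trans
        (mul_le_mul h2 h3 (norm_nonneg _) (norm_nonneg _))
      refine (norm_add_le _ _).trans ?_
      linarith)

/-- The trace operator `H(div, ω) → H¹(ω)'`, `⟨tr τ, v⟩ = ⟨tr v, τ⟩`; it represents the normal
trace `(τ · n)|_{∂ω}`. -/
def traceDiv (ω : Set (EuclideanSpace ℝ (Fin d))) : Hdiv ω →L[ℝ] StrongDual ℝ (H1 ω) :=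
  (traceGrad ω).flip

/-- `H₀(div, ω)`, the elements of `H(div, ω)` with vanishing normal trace. -/
def Hdiv0 (ω : Set (EuclideanSpace ℝ (Fin d))) : Submodule ℝ (Hdiv ω) :=
  LinearMap.ker (traceDiv ω).toLinearMap

/-- `u` solves `(∇div)² u + u = f` in `Ω`, `div u = u · n = 0` on `∂Ω`: all derivatives in
`∇ div ∇ div u` are weak derivatives in `L₂`, and the boundary values are taken in the sense of
traces. Below, `p = div u`, `q = ∇ div u`, `r = div ∇ div u`, `grad r = ∇ div ∇ div u`. -/
def SolvesProblem (Ω : Set (EuclideanSpace ℝ (Fin d))) (f u : L2v Ω) : Prop :=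
  ∃ (w : Hdiv Ω) (p : H1 Ω) (q : Hdiv Ω) (r : H1 Ω),
    fld w = u ∧ fn p = div w ∧ fld q = grad p ∧ fn r = div q ∧
    grad r + u = f ∧
    traceGrad Ω p = 0 ∧ traceDiv Ω w = 0

/-! ### Restriction to subdomains, broken spaces -/

section Restriction

variable {F : Type} [NormedAddCommGroup F] [NormedSpace ℝ F]
  {Ω ω : Set (EuclideanSpace ℝ (Fin d))}

/-- Restriction of an `L₂` function from `Ω` to a subset `ω`. -/
def restr (h : ω ⊆ Ω) : Lp F 2 (volume.restrict Ω) →ₗ[ℝ] Lp F 2 (volume.restrict ω) where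
  toFun u := MemLp.toLp (u : EuclideanSpace ℝ (Fin d) → F)
    ((Lp.memLp u).mono_measure (Measure.restrict_mono_set volume h))
  map_add' u v := by
    rw [← MemLp.toLp_add ((Lp.memLp u).mono_measure (Measure.restrict_mono_set volume h))
      ((Lp.memLp v).mono_measure (Measure.restrict_mono_set volume h))]
    exact MemLp.toLp_congr
      ((Lp.memLp (u + v)).mono_measure (Measure.restrict_mono_set volume h))
      (((Lp.memLp u).mono_measure (Measure.restrict_mono_set volume h)).add
        ((Lp.memLp v).mono_measure (Measure.restrict_mono_set volume h)))
      (ae_mono (Measure.restrict_mono_set volume h) (Lp.coeFn_add u v))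
  map_smul' c u := by
    rw [RingHom.id_apply, ← MemLp.toLp_const_smul c
      ((Lp.memLp u).mono_measure (Measure.restrict_mono_set volume h))]
    exact MemLp.toLp_congr
      ((Lp.memLp (c • u)).mono_measure (Measure.restrict_mono_set volume h))
      (((Lp.memLp u).mono_measure (Measure.restrict_mono_set volume h)).const_smul c)
      (ae_mono (Measure.restrict_mono_set volume h) (Lp.coeFn_smul c u))

lemma restr_coeFn (h : ω ⊆ Ω) (u : Lp F 2 (volume.restrict Ω)) :
    restr h u =ᵐ[volume.restrict ω] u :=
  MemLp.coeFn_toLp ((Lp.memLp u).mono_measure (Measure.restrict_mono_set volume h))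

lemma setIntegral_restrict_eq (h : ω ⊆ Ω) {φ a b : EuclideanSpace ℝ (Fin d) → ℝ}
    (hφ : tsupport φ ⊆ ω) (hab : a =ᵐ[volume.restrict ω] b)
    (hb : ∀ x ∉ tsupport φ, b x = 0) :
    ∫ x in ω, a x = ∫ x in Ω, b x := by
  rw [integral_congr_ae hab, setIntegral_eq_integral_of_forall_compl_eq_zero,
    setIntegral_eq_integral_of_forall_compl_eq_zero]
  · exact fun x hx => hb x fun hx' => hx (h (hφ hx'))
  · exact fun x hx => hb x fun hx' => hx (hφ hx')

lemma fderiv_eq_zero_of_notMem {φ : EuclideanSpace ℝ (Fin d) → ℝ}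
    {x : EuclideanSpace ℝ (Fin d)} (hx : x ∉ tsupport φ) : fderiv ℝ φ x = 0 := by
  by_contra hne
  exact hx (support_fderiv_subset ℝ hne)

lemma IsWeakGrad.restr (h : ω ⊆ Ω) {v : L2 Ω} {g : L2v Ω} (hv : IsWeakGrad Ω v g) :
    IsWeakGrad ω (restr h v) (restr h g) := by
  intro φ hφ e
  have := hv φ (hφ.mono h) e
  rw [setIntegral_restrict_eq h hφ.tsupport_subset (b := fun x => v x * fderiv ℝ φ x e),
    setIntegral_restrict_eq h hφ.tsupport_subset (b := fun x => inner ℝ (g x) e * φ x), this]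
  · filter_upwards [restr_coeFn h g] with x hx
    rw [hx]
  · intro x hx
    simp [image_eq_zero_of_notMem_tsupport hx]
  · filter_upwards [restr_coeFn h v] with x hx
    rw [hx]
  · intro x hx
    simp [fderiv_eq_zero_of_notMem hx]

lemma IsWeakDiv.restr (h : ω ⊆ Ω) {τ : L2v Ω} {δ : L2 Ω} (hv : IsWeakDiv Ω τ δ) :
    IsWeakDiv ω (restr h τ) (restr h δ) := by
  intro φ hφ
  have := hv φ (hφ.mono h)
  rw [setIntegral_restrict_eq h hφ.tsupport_subset (b := fun x => fderiv ℝ φ x (τ x)),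
    setIntegral_restrict_eq h hφ.tsupport_subset (b := fun x => δ x * φ x), this]
  · filter_upwards [restr_coeFn h δ] with x hx
    rw [hx]
  · intro x hx
    simp [image_eq_zero_of_notMem_tsupport hx]
  · filter_upwards [restr_coeFn h τ] with x hx
    rw [hx]
  · intro x hx
    simp [fderiv_eq_zero_of_notMem hx]

/-- Restriction `H¹(Ω) → H¹(ω)`. -/
def H1.restr (h : ω ⊆ Ω) : H1 Ω →ₗ[ℝ] H1 ω where
  toFun v := ⟨WithLp.toLp 2 (GradDiv.restr h (fn v), GradDiv.restr h (grad v)),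
    IsWeakGrad.restr h v.2⟩
  map_add' v w := by
    apply Subtype.ext
    simp only [map_add]
    rfl
  map_smul' c v := by
    apply Subtype.ext
    simp only [map_smul]
    rfl

/-- Restriction `H(div, Ω) → H(div, ω)`. -/
def Hdiv.restr (h : ω ⊆ Ω) : Hdiv Ω →ₗ[ℝ] Hdiv ω where
  toFun τ := ⟨WithLp.toLp 2 (GradDiv.restr h (fld τ), GradDiv.restr h (div τ)),
    IsWeakDiv.restr h τ.2⟩
  map_add' τ σ := by
    apply Subtype.ext
    simp only [map_add]
    rfl
  map_smul' c τ := by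
    apply Subtype.ext
    simp only [map_smul]
    rfl

end Restriction

variable {Ω : Set (EuclideanSpace ℝ (Fin d))}

/-- The broken space `H¹(𝒯) = ∏_T H¹(T)` with the product norm. -/
abbrev BrokenH1 (𝒯 : Mesh Ω) : Type := PiLp 2 (fun i => H1 (𝒯.elem i))

/-- The broken space `H(div, 𝒯) = ∏_T H(div, T)` with the product norm. -/
abbrev BrokenHdiv (𝒯 : Mesh Ω) : Type := PiLp 2 (fun i => Hdiv (𝒯.elem i))

/-- The inclusion `H¹(Ω) → H¹(𝒯)`, `v ↦ (v|_T)_T`. -/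
def toBrokenH1 (𝒯 : Mesh Ω) : H1 Ω →ₗ[ℝ] BrokenH1 𝒯 where
  toFun v := WithLp.toLp 2 fun i => H1.restr (𝒯.elem_subset i) v
  map_add' v w := by ext1 i; exact map_add (H1.restr (𝒯.elem_subset i)) v w
  map_smul' c v := by ext1 i; exact map_smul (H1.restr (𝒯.elem_subset i)) c v

/-- The inclusion `H(div, Ω) → H(div, 𝒯)`, `τ ↦ (τ|_T)_T`. -/
def toBrokenHdiv (𝒯 : Mesh Ω) : Hdiv Ω →ₗ[ℝ] BrokenHdiv 𝒯 where
  toFun τ := WithLp.toLp 2 fun i => Hdiv.restr (𝒯.elem_subset i) τ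
  map_add' τ σ := by ext1 i; exact map_add (Hdiv.restr (𝒯.elem_subset i)) τ σ
  map_smul' c τ := by ext1 i; exact map_smul (Hdiv.restr (𝒯.elem_subset i)) c τ

/-! ### Traces on the skeleton -/

/-- The skeleton trace operator `H¹(𝒯) → H(div, 𝒯)'`,
`⟨tr v, τ⟩_𝒮 = ∑_T ((v, div τ)_T + (∇v, τ)_T)`. -/
def skelTraceGrad (𝒯 : Mesh Ω) : BrokenH1 𝒯 →L[ℝ] StrongDual ℝ (BrokenHdiv 𝒯) :=
  ∑ i, (traceGrad (𝒯.elem i)).bilinearComp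
    (PiLp.proj 2 (𝕜 := ℝ) (fun i => H1 (𝒯.elem i)) i)
    (PiLp.proj 2 (𝕜 := ℝ) (fun i => Hdiv (𝒯.elem i)) i)

lemma traceGrad_apply {ω : Set (EuclideanSpace ℝ (Fin d))} (v : H1 ω) (τ : Hdiv ω) :
    traceGrad ω v τ = inner ℝ (fn v) (div τ) + inner ℝ (grad v) (fld τ) := rfl

lemma skelTraceGrad_apply (𝒯 : Mesh Ω) (v : BrokenH1 𝒯) (τ : BrokenHdiv 𝒯) :
    skelTraceGrad 𝒯 v τ =
      ∑ i, (inner ℝ (fn (v i)) (div (τ i)) + inner ℝ (grad (v i)) (fld (τ i))) := by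
  simp [skelTraceGrad, traceGrad_apply]

/-- The skeleton trace operator `H(div, 𝒯) → H¹(𝒯)'`, `⟨tr τ, v⟩_𝒮 = ⟨tr v, τ⟩_𝒮`. -/
def skelTraceDiv (𝒯 : Mesh Ω) : BrokenHdiv 𝒯 →L[ℝ] StrongDual ℝ (BrokenH1 𝒯) :=
  (skelTraceGrad 𝒯).flip

/-- The skeleton trace of a function in `H¹(Ω)`. -/
def globalTraceGrad (𝒯 : Mesh Ω) : H1 Ω →ₗ[ℝ] StrongDual ℝ (BrokenHdiv 𝒯) :=
  (skelTraceGrad 𝒯).toLinearMap ∘ₗ toBrokenH1 𝒯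

/-- The skeleton trace of a vector field in `H(div, Ω)`. -/
def globalTraceDiv (𝒯 : Mesh Ω) : Hdiv Ω →ₗ[ℝ] StrongDual ℝ (BrokenH1 𝒯) :=
  (skelTraceDiv 𝒯).toLinearMap ∘ₗ toBrokenHdiv 𝒯

/-- `H^{1/2}(𝒮)`, the skeleton traces of `H¹(Ω)`. -/
def HHalf (𝒯 : Mesh Ω) : Submodule ℝ (StrongDual ℝ (BrokenHdiv 𝒯)) :=
  LinearMap.range (globalTraceGrad 𝒯)

/-- `H^{1/2}_0(𝒮)`, the skeleton traces of `H¹₀(Ω)`. -/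
def HHalf0 (𝒯 : Mesh Ω) : Submodule ℝ (StrongDual ℝ (BrokenHdiv 𝒯)) :=
  (H10 Ω).map (globalTraceGrad 𝒯)

/-- `H^{-1/2}(𝒮)`, the skeleton traces of `H(div, Ω)`. -/
def HMinusHalf (𝒯 : Mesh Ω) : Submodule ℝ (StrongDual ℝ (BrokenH1 𝒯)) :=
  LinearMap.range (globalTraceDiv 𝒯)

/-- `H^{-1/2}_0(𝒮)`, the skeleton traces of `H₀(div, Ω)`. -/
def HMinusHalf0 (𝒯 : Mesh Ω) : Submodule ℝ (StrongDual ℝ (BrokenH1 𝒯)) :=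
  (Hdiv0 Ω).map (globalTraceDiv 𝒯)

/-- `‖v̂‖_{1/2,𝒮} = inf {‖v‖₁ ; v ∈ H¹(Ω), tr v = v̂}`. -/
def normHalf (𝒯 : Mesh Ω) (vhat : StrongDual ℝ (BrokenHdiv 𝒯)) : ℝ :=
  sInf ((fun v : H1 Ω => ‖v‖) '' {v | globalTraceGrad 𝒯 v = vhat})

/-- `‖τ̂‖_{-1/2,𝒮} = inf {‖τ‖_div ; τ ∈ H(div, Ω), tr τ = τ̂}`. -/
def normMinusHalf (𝒯 : Mesh Ω) (τhat : StrongDual ℝ (BrokenH1 𝒯)) : ℝ :=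
  sInf ((fun τ : Hdiv Ω => ‖τ‖) '' {τ | globalTraceDiv 𝒯 τ = τhat})

/-! ### The ultraweak formulation -/

/-- The trial space `𝔘 = 𝑳₂(Ω) × L₂(Ω) × 𝑳₂(Ω) × L₂(Ω) ×
H^{-1/2}_0(𝒮) × H^{1/2}_0(𝒮) × H^{-1/2}(𝒮) × H^{1/2}(𝒮)`. -/
@[ext] structure Trial (𝒯 : Mesh Ω) where
  u₁ : L2v Ω
  u₂ : L2 Ω
  u₃ : L2v Ω
  u₄ : L2 Ω
  uhat₁ : HMinusHalf0 𝒯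
  uhat₂ : HHalf0 𝒯
  uhat₃ : HMinusHalf 𝒯
  uhat₄ : HHalf 𝒯

/-- The norm `‖·‖_𝔘`. -/
def Trial.norm {𝒯 : Mesh Ω} (u : Trial 𝒯) : ℝ :=
  Real.sqrt (‖u.u₁‖ ^ 2 + ‖u.u₂‖ ^ 2 + ‖u.u₃‖ ^ 2 + ‖u.u₄‖ ^ 2
    + normMinusHalf 𝒯 u.uhat₁ ^ 2 + normHalf 𝒯 u.uhat₂ ^ 2
    + normMinusHalf 𝒯 u.uhat₃ ^ 2 + normHalf 𝒯 u.uhat₄ ^ 2)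

/-- The test space `𝔙(𝒯) = H(div, 𝒯) × H¹(𝒯) × H(div, 𝒯) × H¹(𝒯)`. -/
structure Test (𝒯 : Mesh Ω) where
  v₁ : BrokenHdiv 𝒯
  v₂ : BrokenH1 𝒯
  v₃ : BrokenHdiv 𝒯
  v₄ : BrokenH1 𝒯

/-- The bilinear form `b(𝔲, 𝔳)`. -/
def bform (𝒯 : Mesh Ω) (u : Trial 𝒯) (v : Test 𝒯) : ℝ :=
  (∑ i, inner ℝ (restr (𝒯.elem_subset i) u.u₁) (fld (v.v₁ i) - grad (v.v₄ i)))
  - (∑ i, inner ℝ (restr (𝒯.elem_subset i) u.u₂) (fn (v.v₄ i) + div (v.v₃ i)))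
  - (∑ i, inner ℝ (restr (𝒯.elem_subset i) u.u₃) (fld (v.v₃ i) + grad (v.v₂ i)))
  - (∑ i, inner ℝ (restr (𝒯.elem_subset i) u.u₄) (fn (v.v₂ i) + div (v.v₁ i)))
  + (u.uhat₁ : StrongDual ℝ (BrokenH1 𝒯)) v.v₄
  + (u.uhat₂ : StrongDual ℝ (BrokenHdiv 𝒯)) v.v₃
  + (u.uhat₃ : StrongDual ℝ (BrokenH1 𝒯)) v.v₂
  + (u.uhat₄ : StrongDual ℝ (BrokenHdiv 𝒯)) v.v₁

/-- The functional `L(𝔳) = (f, v₁)`. -/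
def Lform (𝒯 : Mesh Ω) (f : L2v Ω) (v : Test 𝒯) : ℝ :=
  ∑ i, inner ℝ (restr (𝒯.elem_subset i) f) (fld (v.v₁ i))

/-- `𝔲` solves the ultraweak formulation: `b(𝔲, 𝔳) = L(𝔳)` for all `𝔳 ∈ 𝔙(𝒯)`. -/
def SolvesUltraweak (𝒯 : Mesh Ω) (f : L2v Ω) (u : Trial 𝒯) : Prop :=
  ∀ v : Test 𝒯, bform 𝒯 u v = Lform 𝒯 f v

end GradDiv

end

noncomputable section

namespace GradDiv

open MeasureTheory Set Filter
open scoped NNReal Topology ENNReal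

variable {d : ℕ} {ω Ω U B : Set (EuclideanSpace ℝ (Fin d))}

/-! ### Test functions as elements of the function spaces -/

section TestFunctions

variable {φ ψ : EuclideanSpace ℝ (Fin d) → ℝ}

/-! Put `p = div u` and `r = div ∇ div u`, so that `u = f - ∇r`. The boundary value problem then
becomes a mesh-free system for `r ∈ H¹` and `p ∈ H¹₀`: `(s, p) + (∇s, f - ∇r) = 0` for all `s ∈ H¹`,
which says `div u = p` and `u · n = 0`, and `(w, r) + (∇w, ∇p) = 0` for all `w ∈ H¹₀`, which says
`div ∇p = r`. This is `IsReducedSolution`.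

The system is well posed although its diagonal gives only `‖∇r‖² + ‖∇p‖²`. Adding the test pair
`(-p, ∑ (r, w_i) w_i)` also produces `‖p‖²` and `∑ (r, w_i)²`. The norm of `r` is recovered from
`‖v‖² ≤ C (∑ (v, w_i)² + ‖∇v‖²)` with finitely many `w_i` in `H¹₀`; membership in `H¹₀` is what
makes the `w_i` admissible in the second equation. The inequality (`exists_poincare`) is proved
locally, where a Lipschitz domain is star-shaped with respect to a ball, and globalised by
compactness.

Ultraweak solutions and reduced solutions correspond to each other (`trial_solvesUltraweak`,
`exists_eq_trial`). Conforming test functions reduce skeleton traces to boundary traces, so the four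
field unknowns are tied together by weak derivatives and boundary conditions; broken test functions
then determine the skeleton unknowns from the fields. The constant does not see the mesh because the
reduced problem does not, and because the skeleton norms are infima over extensions to `Ω`. -/

lemma inner_gradient_right (φ : EuclideanSpace ℝ (Fin d) → ℝ) (x y : EuclideanSpace ℝ (Fin d)) :
    inner ℝ y (gradient φ x) = fderiv ℝ φ x y := by
  rw [real_inner_comm, ← InnerProductSpace.toDual_apply_apply (𝕜 := ℝ), toDual_gradient]

lemma IsTestFunction.memLp_gradient (h : IsTestFunction ω φ) :
    MemLp (gradient φ) 2 (volume.restrict ω) := by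
  have hc : Continuous (gradient φ) :=
    (InnerProductSpace.toDual ℝ (EuclideanSpace ℝ (Fin d))).symm.continuous.comp
      (h.contDiff.continuous_fderiv (by simp))
  refine h.memLp_fderiv.of_le hc.aestronglyMeasurable (Eventually.of_forall fun x => ?_)
  rw [gradient, LinearIsometryEquiv.norm_map]

lemma IsTestFunction.memLp_smul_const (h : IsTestFunction ω φ) (e : EuclideanSpace ℝ (Fin d)) :
    MemLp (fun x => φ x • e) 2 (volume.restrict ω) :=
  (ContinuousLinearMap.toSpanSingleton ℝ e).comp_memLp' h.memLp

/-- A test function as an element of `L₂`. -/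
def IsTestFunction.toL2 (h : IsTestFunction ω φ) : L2 ω := h.memLp.toLp φ

/-- The classical gradient of a test function as an element of `𝑳₂`. -/
def IsTestFunction.gradL2 (h : IsTestFunction ω φ) : L2v ω := h.memLp_gradient.toLp _

/-- A directional derivative of a test function as an element of `L₂`. -/
def IsTestFunction.derivL2 (h : IsTestFunction ω φ) (e : EuclideanSpace ℝ (Fin d)) : L2 ω :=
  (h.memLp_fderiv_apply e).toLp _

/-- The vector field `φ e` as an element of `𝑳₂`. -/
def IsTestFunction.vecL2 (h : IsTestFunction ω φ) (e : EuclideanSpace ℝ (Fin d)) : L2v ω :=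
  (h.memLp_smul_const e).toLp _

lemma IsTestFunction.inner_toL2 (h : IsTestFunction ω φ) (v : L2 ω) :
    inner ℝ v h.toL2 = ∫ x in ω, v x * φ x := by
  rw [L2.inner_def]
  refine integral_congr_ae ?_
  filter_upwards [h.memLp.coeFn_toLp] with x hx
  rw [IsTestFunction.toL2, hx, real_inner_eq_re_inner, RCLike.inner_apply]
  simp [mul_comm]

lemma IsTestFunction.inner_derivL2 (h : IsTestFunction ω φ) (e : EuclideanSpace ℝ (Fin d))
    (v : L2 ω) : inner ℝ v (h.derivL2 e) = ∫ x in ω, v x * fderiv ℝ φ x e := by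
  rw [L2.inner_def]
  refine integral_congr_ae ?_
  filter_upwards [(h.memLp_fderiv_apply e).coeFn_toLp] with x hx
  rw [IsTestFunction.derivL2, hx, real_inner_eq_re_inner, RCLike.inner_apply]
  simp [mul_comm]

lemma IsTestFunction.inner_gradL2 (h : IsTestFunction ω φ) (τ : L2v ω) :
    inner ℝ τ h.gradL2 = ∫ x in ω, fderiv ℝ φ x (τ x) := by
  rw [L2.inner_def]
  refine integral_congr_ae ?_
  filter_upwards [h.memLp_gradient.coeFn_toLp] with x hx
  rw [IsTestFunction.gradL2, hx, inner_gradient_right]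

lemma IsTestFunction.inner_vecL2 (h : IsTestFunction ω φ) (e : EuclideanSpace ℝ (Fin d))
    (g : L2v ω) : inner ℝ g (h.vecL2 e) = ∫ x in ω, inner ℝ (g x) e * φ x := by
  rw [L2.inner_def]
  refine integral_congr_ae ?_
  filter_upwards [(h.memLp_smul_const e).coeFn_toLp] with x hx
  rw [IsTestFunction.vecL2, hx, real_inner_smul_right, mul_comm]

/-- In terms of `L₂` inner products the definition is a family of closed conditions, which gives
completeness of `H1`. -/
lemma isWeakGrad_iff {v : L2 ω} {g : L2v ω} :
    IsWeakGrad ω v g ↔ ∀ φ (h : IsTestFunction ω φ) e,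
      inner ℝ v (h.derivL2 e) = - inner ℝ g (h.vecL2 e) := by
  refine forall_congr' fun φ => forall_congr' fun h => forall_congr' fun e => ?_
  rw [h.inner_derivL2, h.inner_vecL2]

lemma isWeakDiv_iff {τ : L2v ω} {δ : L2 ω} :
    IsWeakDiv ω τ δ ↔ ∀ φ (h : IsTestFunction ω φ),
      inner ℝ τ h.gradL2 = - inner ℝ δ h.toL2 := by
  refine forall_congr' fun φ => forall_congr' fun h => ?_
  rw [h.inner_gradL2, h.inner_toL2]

lemma IsTestFunction.integral_mul_fderiv (hφ : IsTestFunction ω φ) (hψ : IsTestFunction ω ψ)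
    (e : EuclideanSpace ℝ (Fin d)) :
    ∫ x in ω, φ x * fderiv ℝ ψ x e = - ∫ x in ω, fderiv ℝ φ x e * ψ x := by
  rw [setIntegral_eq_integral_of_forall_compl_eq_zero fun x hx => by
      rw [image_eq_zero_of_notMem_tsupport fun h => hx (hφ.tsupport_subset h), zero_mul],
    setIntegral_eq_integral_of_forall_compl_eq_zero fun x hx => by
      rw [image_eq_zero_of_notMem_tsupport fun h => hx (hψ.tsupport_subset h), mul_zero]]
  have c1 := hφ.contDiff.continuous
  have c2 := hψ.contDiff.continuous
  have c3 : Continuous fun x => fderiv ℝ φ x e :=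
    (hφ.contDiff.continuous_fderiv (by simp)).clm_apply continuous_const
  have c4 : Continuous fun x => fderiv ℝ ψ x e :=
    (hψ.contDiff.continuous_fderiv (by simp)).clm_apply continuous_const
  refine integral_mul_fderiv_eq_neg_fderiv_mul_of_integrable ?_ ?_ ?_ ?_ ?_
  · exact (c3.mul c2).integrable_of_hasCompactSupport hψ.hasCompactSupport.mul_left
  · exact (c1.mul c4).integrable_of_hasCompactSupport hφ.hasCompactSupport.mul_right
  · exact (c1.mul c2).integrable_of_hasCompactSupport hφ.hasCompactSupport.mul_right
  · exact fun x _ => hφ.contDiff.differentiable (by simp) x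
  · exact fun x _ => hψ.contDiff.differentiable (by simp) x

/-- A test function as an element of `H¹`. -/
def IsTestFunction.toH1 (h : IsTestFunction ω φ) : H1 ω :=
  ⟨WithLp.toLp 2 (h.toL2, h.gradL2), fun ψ hψ e => by
    have h1 : ∫ x in ω, h.toL2 x * fderiv ℝ ψ x e = ∫ x in ω, φ x * fderiv ℝ ψ x e :=
      integral_congr_ae (by
        filter_upwards [h.memLp.coeFn_toLp] with x hx
        rw [IsTestFunction.toL2, hx])
    have h2 : ∫ x in ω, inner ℝ (h.gradL2 x) e * ψ x = ∫ x in ω, fderiv ℝ φ x e * ψ x :=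
      integral_congr_ae (by
        filter_upwards [h.memLp_gradient.coeFn_toLp] with x hx
        rw [IsTestFunction.gradL2, hx, real_inner_comm, inner_gradient_right])
    exact h1.trans ((h.integral_mul_fderiv hψ e).trans (congrArg Neg.neg h2.symm))⟩

/-- The vector field `φ e`, for a test function `φ`, as an element of `H(div)`. -/
def IsTestFunction.toHdiv (h : IsTestFunction ω φ) (e : EuclideanSpace ℝ (Fin d)) : Hdiv ω :=
  ⟨WithLp.toLp 2 (h.vecL2 e, h.derivL2 e), fun ψ hψ => by
    have h1 : ∫ x in ω, fderiv ℝ ψ x (h.vecL2 e x) = ∫ x in ω, φ x * fderiv ℝ ψ x e :=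
      integral_congr_ae (by
        filter_upwards [(h.memLp_smul_const e).coeFn_toLp] with x hx
        rw [IsTestFunction.vecL2, hx, map_smul, smul_eq_mul])
    have h2 : ∫ x in ω, h.derivL2 e x * ψ x = ∫ x in ω, fderiv ℝ φ x e * ψ x :=
      integral_congr_ae (by
        filter_upwards [(h.memLp_fderiv_apply e).coeFn_toLp] with x hx
        rw [IsTestFunction.derivL2, hx])
    exact h1.trans ((h.integral_mul_fderiv hψ e).trans (congrArg Neg.neg h2.symm))⟩

lemma IsTestFunction.fn_toH1 (h : IsTestFunction ω φ) : fn h.toH1 = h.toL2 := rfl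

lemma IsTestFunction.grad_toH1 (h : IsTestFunction ω φ) : grad h.toH1 = h.gradL2 := rfl

lemma IsTestFunction.fld_toHdiv (h : IsTestFunction ω φ) (e : EuclideanSpace ℝ (Fin d)) :
    fld (h.toHdiv e) = h.vecL2 e := rfl

lemma IsTestFunction.div_toHdiv (h : IsTestFunction ω φ) (e : EuclideanSpace ℝ (Fin d)) :
    div (h.toHdiv e) = h.derivL2 e := rfl

lemma IsTestFunction.toH1_mem_H10 (h : IsTestFunction ω φ) : h.toH1 ∈ H10 ω :=
  Submodule.le_topologicalClosure _ (show h.toH1 ∈ testSubmodule ω from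
    ⟨φ, h, h.memLp.coeFn_toLp⟩)

/-- The hypothesis has the shape of the trace pairing with `φ e`, which is what the variational
equations deliver directly. -/
lemma isWeakGrad_of_forall_toHdiv {v : L2 ω} {g : L2v ω}
    (H : ∀ φ (h : IsTestFunction ω φ) e,
      inner ℝ v (div (h.toHdiv e)) + inner ℝ g (fld (h.toHdiv e)) = 0) :
    IsWeakGrad ω v g :=
  isWeakGrad_iff.2 fun φ h e => eq_neg_of_add_eq_zero_left (H φ h e)

lemma isWeakDiv_of_forall_toH1 {τ : L2v ω} {δ : L2 ω}
    (H : ∀ φ (h : IsTestFunction ω φ),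
      inner ℝ (fn h.toH1) δ + inner ℝ (grad h.toH1) τ = 0) :
    IsWeakDiv ω τ δ :=
  isWeakDiv_iff.2 fun φ h => by
    have := H φ h
    rw [real_inner_comm, real_inner_comm τ] at this
    exact eq_neg_of_add_eq_zero_right this

end TestFunctions

/-! ### Hilbert space structure -/

lemma H1.ext {v w : H1 ω} (h : fn v = fn w) (h' : grad v = grad w) : v = w := by
  apply Subtype.ext
  apply (WithLp.equiv 2 _).injective
  exact Prod.ext h h'

lemma Hdiv.ext {σ τ : Hdiv ω} (h : fld σ = fld τ) (h' : div σ = div τ) : σ = τ := by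
  apply Subtype.ext
  apply (WithLp.equiv 2 _).injective
  exact Prod.ext h h'

lemma inner_H1 (v w : H1 ω) :
    inner ℝ v w = inner ℝ (fn v) (fn w) + inner ℝ (grad v) (grad w) :=
  WithLp.prod_inner_apply _ _

lemma norm_sq_H1 (v : H1 ω) : ‖v‖ ^ 2 = ‖fn v‖ ^ 2 + ‖grad v‖ ^ 2 :=
  WithLp.prod_norm_sq_eq_of_L2 (v : WithLp 2 (L2 ω × L2v ω))

lemma norm_sq_Hdiv (τ : Hdiv ω) : ‖τ‖ ^ 2 = ‖fld τ‖ ^ 2 + ‖div τ‖ ^ 2 :=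
  WithLp.prod_norm_sq_eq_of_L2 (τ : WithLp 2 (L2v ω × L2 ω))

lemma norm_fn_le (v : H1 ω) : ‖fn v‖ ≤ ‖v‖ :=
  WithLp.norm_fst_le _ (v : WithLp 2 (L2 ω × L2v ω))

lemma norm_grad_le (v : H1 ω) : ‖grad v‖ ≤ ‖v‖ :=
  WithLp.norm_snd_le _ (v : WithLp 2 (L2 ω × L2v ω))

lemma isClosed_H1 : IsClosed (H1 ω : Set (WithLp 2 (L2 ω × L2v ω))) := by
  have : (H1 ω : Set (WithLp 2 (L2 ω × L2v ω))) =
      ⋂ (φ) (h : IsTestFunction ω φ) (e),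
        {p | inner ℝ p.fst (h.derivL2 e) = - inner ℝ p.snd (h.vecL2 e)} := by
    ext p
    simp only [mem_iInter, mem_ofPred_eq]
    exact isWeakGrad_iff
  rw [this]
  refine isClosed_iInter fun φ => isClosed_iInter fun h => isClosed_iInter fun e => ?_
  exact isClosed_eq ((WithLp.continuous_fst 2 _ _).inner continuous_const)
    ((WithLp.continuous_snd 2 _ _).inner continuous_const).neg

instance : CompleteSpace (H1 ω) := isClosed_H1.completeSpace_coe

instance : CompleteSpace (H10 ω) :=
  (Submodule.isClosed_topologicalClosure (testSubmodule ω)).completeSpace_coe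

/-! ### Density of test functions -/

lemma ae_eq_zero_of_forall_test {F : Type} [NormedAddCommGroup F] [NormedSpace ℝ F]
    [CompleteSpace F] (hω : IsOpen ω) (u : Lp F 2 (volume.restrict ω))
    (h : ∀ φ, IsTestFunction ω φ → ∫ x in ω, φ x • u x = 0) : u = 0 := by
  have hloc : LocallyIntegrableOn (u : EuclideanSpace ℝ (Fin d) → F) ω volume := by
    rw [locallyIntegrableOn_iff hω.isLocallyClosed]
    intro k hk hkc
    have : MemLp (u : EuclideanSpace ℝ (Fin d) → F) 2 (volume.restrict k) :=
      (Lp.memLp u).mono_measure (Measure.restrict_mono_set volume hk)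
    have : IsFiniteMeasure (volume.restrict k) := ⟨by
      rw [Measure.restrict_apply_univ]; exact hkc.measure_lt_top⟩
    exact MemLp.integrable one_le_two ‹MemLp _ 2 (volume.restrict k)›
  have := hω.ae_eq_zero_of_integral_contDiff_smul_eq_zero hloc fun g hg hgc hgω => by
    rw [← h g ⟨hg, hgc, hgω⟩, setIntegral_eq_integral_of_forall_compl_eq_zero]
    intro x hx
    rw [image_eq_zero_of_notMem_tsupport fun h => hx (hgω h), zero_smul]
  rw [Lp.eq_zero_iff_ae_eq_zero]
  exact (ae_restrict_iff' hω.measurableSet).2 this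

/-- `testSubmodule` prescribes only the function and not the gradient. Since the function determines
its weak gradient, the members of `testSubmodule` are exactly the `toH1` of test functions. -/
lemma H1.fn_injective (hω : IsOpen ω) {v w : H1 ω} (h : fn v = fn w) : v = w := by
  refine H1.ext h (sub_eq_zero.1 ?_)
  rw [← map_sub]
  refine ae_eq_zero_of_forall_test hω _ fun φ hφ => ?_
  refine ext_inner_left ℝ fun e => ?_
  have hint : Integrable (fun x => φ x • grad (v - w) x) (volume.restrict ω) :=
    memLp_one_iff_integrable.1 ((Lp.memLp (grad (v - w))).smul hφ.memLp)
  rw [inner_zero_right, ← integral_inner hint]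
  have h0 : fn (v - w) = 0 := by rw [map_sub, h, sub_self]
  have := isWeakGrad_iff.1 (v - w).2 φ hφ e
  change inner ℝ (fn (v - w)) _ = - inner ℝ (grad (v - w)) _ at this
  rw [h0, inner_zero_left, hφ.inner_vecL2] at this
  rw [← neg_eq_zero, this]
  congr 2
  ext x
  rw [real_inner_smul_right, real_inner_comm, mul_comm]

lemma traceGrad_toH1 {φ : EuclideanSpace ℝ (Fin d) → ℝ} (h : IsTestFunction ω φ) (τ : Hdiv ω) :
    traceGrad ω h.toH1 τ = 0 := by
  have := isWeakDiv_iff.1 τ.2 φ h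
  change inner ℝ (fld τ) _ = - inner ℝ (div τ) _ at this
  rw [traceGrad_apply, h.fn_toH1, h.grad_toH1, real_inner_comm, real_inner_comm (fld τ), this]
  ring

/-- `H¹₀` consists of the elements of `H¹` with vanishing trace. -/
lemma mem_H10_iff (hω : IsOpen ω) (v : H1 ω) : v ∈ H10 ω ↔ traceGrad ω v = 0 := by
  constructor
  · intro hv
    have hcl : IsClosed {v : H1 ω | traceGrad ω v = 0} :=
      isClosed_eq (traceGrad ω).continuous continuous_const
    refine closure_minimal ?_ hcl hv
    rintro w ⟨φ, hφ, hw⟩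
    have : w = hφ.toH1 := H1.fn_injective hω
      (Lp.ext (hw.trans hφ.memLp.coeFn_toLp.symm))
    ext τ
    rw [this, traceGrad_toH1]
    rfl
  · intro hv
    -- Orthogonality of `z` to the test functions in the `H¹` inner product says `div ∇z = z`, so
    -- `(∇z, z)` lies in `Hdiv`. Pairing the trace of `y + z` with this field gives `(y + z, z)_{H¹}
    -- = ‖z‖²`, whence `z = 0`.
    obtain ⟨y, hy, z, hz, rfl⟩ := (H10 ω).exists_add_mem_mem_orthogonal v
    have hz' : IsWeakDiv ω (grad z) (fn z) := isWeakDiv_of_forall_toH1 fun φ hφ => by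
      rw [← inner_H1]
      exact hz _ hφ.toH1_mem_H10
    have h1 := DFunLike.congr_fun hv ⟨WithLp.toLp 2 (grad z, fn z), hz'⟩
    have h2 : inner ℝ (y + z) z = (0 : ℝ) := by
      rw [inner_H1]
      exact h1
    rw [inner_add_left, hz y hy, zero_add, inner_self_eq_zero] at h2
    rw [h2, add_zero]
    exact hy

/-! ### Translations of `H¹` functions -/

lemma lintegral_enorm_sq_eq {α F : Type} [MeasurableSpace α] {μ : Measure α}
    [NormedAddCommGroup F] {f : α → F} (hf : MemLp f 2 μ) :
    ∫⁻ x, ‖f x‖ₑ ^ 2 ∂μ = ENNReal.ofReal (‖hf.toLp f‖ ^ 2) := by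
  have h := eLpNorm_nnreal_pow_eq_lintegral (μ := μ) (f := f) (p := 2) two_ne_zero
  simp only [NNReal.coe_ofNat, ENNReal.rpow_ofNat, ENNReal.coe_ofNat] at h
  rw [← h, ← Lp.enorm_toLp hf, ENNReal.ofReal_pow (norm_nonneg _), ofReal_norm]

/-- In `L₂(ω)` the norm may be computed by pairing with test functions. -/
lemma norm_le_of_forall_test (hω : IsOpen ω) (u : L2 ω) (M : ℝ)
    (h : ∀ φ (hφ : IsTestFunction ω φ), |inner ℝ u hφ.toL2| ≤ M * ‖hφ.toL2‖) :
    ‖u‖ ≤ M ∨ u = 0 := by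
  have htest : ∀ v ∈ (testSubmodule ω).map fn, ∃ φ, ∃ hφ : IsTestFunction ω φ, v = hφ.toL2 := by
    rintro _ ⟨v, ⟨φ, hφ, hv⟩, rfl⟩
    exact ⟨φ, hφ, Lp.ext (hv.trans hφ.memLp.coeFn_toLp.symm)⟩
  have hdense : ((testSubmodule ω).map (fn : H1 ω →ₗ[ℝ] L2 ω)).topologicalClosure = ⊤ := by
    rw [Submodule.topologicalClosure_eq_top_iff, Submodule.eq_bot_iff]
    intro w hw
    refine ae_eq_zero_of_forall_test hω w fun φ hφ => ?_
    have := hw hφ.toL2 ⟨hφ.toH1, ⟨φ, hφ, hφ.memLp.coeFn_toLp⟩, rfl⟩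
    rw [real_inner_comm, hφ.inner_toL2] at this
    rw [← this]
    simp only [smul_eq_mul, mul_comm]
  have hcl : IsClosed {v : L2 ω | |inner ℝ u v| ≤ M * ‖v‖} :=
    isClosed_le (continuous_const.inner continuous_id).abs (continuous_const.mul continuous_norm)
  -- The bound passes from test functions to their closure, which is everything; it is then used at
  -- `v = u`.
  have hall : u ∈ {v : L2 ω | |inner ℝ u v| ≤ M * ‖v‖} := by
    refine closure_minimal (s := ((testSubmodule ω).map (fn : H1 ω →ₗ[ℝ] L2 ω) : Set (L2 ω)))
      ?_ hcl ?_
    · intro v hv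
      obtain ⟨φ, hφ, rfl⟩ := htest v hv
      exact h φ hφ
    · rw [← Submodule.topologicalClosure_coe, hdense]
      trivial
  rw [mem_ofPred_eq, real_inner_self_eq_norm_mul_norm, abs_of_nonneg (by positivity)] at hall
  -- The sign of `M` is not assumed, so `u = 0` has to remain a separate alternative.
  by_cases hu : u = 0
  · exact Or.inr hu
  · exact Or.inl (le_of_mul_le_mul_right hall (norm_pos_iff.2 hu))

section Translation

variable {φ : EuclideanSpace ℝ (Fin d) → ℝ}

lemma IsTestFunction.translate (h : IsTestFunction U φ) (a : EuclideanSpace ℝ (Fin d))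
    (ha : ∀ x ∈ U, x + a ∈ Ω) : IsTestFunction Ω (fun y => φ (y - a)) where
  contDiff := h.contDiff.comp (contDiff_id.sub contDiff_const)
  hasCompactSupport := h.hasCompactSupport.comp_homeomorph (Homeomorph.subRight a)
  tsupport_subset := by
    have : tsupport (fun y => φ (y - a)) = (Homeomorph.subRight a) ⁻¹' tsupport φ :=
      tsupport_comp_eq_preimage φ (Homeomorph.subRight a)
    rw [this]
    intro y hy
    simpa using ha _ (h.tsupport_subset hy)

lemma IsTestFunction.norm_toL2_sq (h : IsTestFunction ω φ) : ‖h.toL2‖ ^ 2 = ∫ x, φ x ^ 2 := by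
  rw [← real_inner_self_eq_norm_sq, h.inner_toL2,
    ← setIntegral_eq_integral_of_forall_compl_eq_zero (s := ω) (f := fun x => φ x ^ 2)
      fun x hx => by
        simp [image_eq_zero_of_notMem_tsupport fun h' => hx (h.tsupport_subset h')]]
  refine integral_congr_ae ?_
  filter_upwards [h.memLp.coeFn_toLp] with x hx
  rw [IsTestFunction.toL2, hx, sq]

lemma IsTestFunction.norm_vecL2_le (h : IsTestFunction ω φ) (e : EuclideanSpace ℝ (Fin d)) :
    ‖h.vecL2 e‖ ≤ ‖e‖ * ‖h.toL2‖ := by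
  refine Lp.norm_le_mul_norm_of_ae_le_mul ?_
  filter_upwards [h.memLp.coeFn_toLp, (h.memLp_smul_const e).coeFn_toLp] with x hx hx'
  rw [IsTestFunction.toL2, IsTestFunction.vecL2, hx, hx', norm_smul, mul_comm]

lemma IsTestFunction.setIntegral_mul (h : IsTestFunction ω φ) (v : EuclideanSpace ℝ (Fin d) → ℝ) :
    ∫ x in ω, v x * φ x = ∫ x, v x * φ x :=
  setIntegral_eq_integral_of_forall_compl_eq_zero fun x hx => by
    rw [image_eq_zero_of_notMem_tsupport fun h' => hx (h.tsupport_subset h'), mul_zero]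

lemma integrable_of_isBounded (hb : Bornology.IsBounded Ω) (v : L2 Ω) :
    Integrable v (volume.restrict Ω) := by
  have : IsFiniteMeasure (volume.restrict Ω) := ⟨by
    rw [Measure.restrict_apply_univ]; exact hb.measure_lt_top⟩
  exact (Lp.memLp v).integrable one_le_two

/-- The translation is put on the smooth factor `φ`, so `v` needs only integrability; boundedness of
`∂_h φ` provides the dominating function. -/
lemma hasDerivAt_integral_translate (hb : Bornology.IsBounded Ω) (v : L2 Ω)
    (hφ : ContDiff ℝ (⊤ : ℕ∞) φ) (hc : HasCompactSupport φ) (h : EuclideanSpace ℝ (Fin d)) (t : ℝ) :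
    HasDerivAt (fun t : ℝ => ∫ y in Ω, v y * φ (y - t • h))
      (∫ y in Ω, v y * -(fderiv ℝ φ (y - t • h) h)) t := by
  have hv := integrable_of_isBounded hb v
  have hc' : Continuous fun x => fderiv ℝ φ x h :=
    (hφ.continuous_fderiv (by simp)).clm_apply continuous_const
  obtain ⟨C, hC⟩ := hc.exists_bound_of_continuous hφ.continuous
  obtain ⟨C', hC'⟩ := (hc.fderiv_apply (𝕜 := ℝ) h).exists_bound_of_continuous hc'
  have htr : ∀ s : ℝ, Continuous fun y : EuclideanSpace ℝ (Fin d) => y - s • h :=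
    fun s => continuous_id.sub continuous_const
  refine (hasDerivAt_integral_of_dominated_loc_of_deriv_le (bound := fun y => ‖v y‖ * C')
    (F := fun t y => v y * φ (y - t • h))
    (F' := fun t y => v y * -(fderiv ℝ φ (y - t • h) h)) univ_mem ?_ ?_ ?_ ?_ ?_ ?_).2
  · exact Eventually.of_forall fun s => hv.1.mul
      (hφ.continuous.comp (htr s)).aestronglyMeasurable
  · exact hv.mul_bdd (c := C) (hφ.continuous.comp (htr t)).aestronglyMeasurable
      (Eventually.of_forall fun y => hC _)
  · exact hv.1.mul (hc'.comp (htr t)).neg.aestronglyMeasurable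
  · refine Eventually.of_forall fun y s _ => ?_
    rw [norm_mul, norm_neg]
    exact mul_le_mul_of_nonneg_left (hC' _) (norm_nonneg _)
  · exact hv.norm.mul_const _
  · refine Eventually.of_forall fun y s _ => HasDerivAt.const_mul _ ?_
    have h1 : HasDerivAt (fun s : ℝ => y - s • h) (-h) s := by
      simpa using ((hasDerivAt_id s).smul_const h).const_sub y
    have h2 : HasDerivAt (fun s : ℝ => φ (y - s • h)) (fderiv ℝ φ (y - s • h) (-h)) s :=
      (hφ.differentiable (by simp) (y - s • h)).hasFDerivAt.comp_hasDerivAt s h1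
    rwa [map_neg] at h2

/-- By duality: paired with a test function `φ` on `U`, the difference equals `K 1 - K 0` with `K t
= ∫ v φ(· - t h)`. The translates of `φ` stay supported in `Ω` because the segments do, so `K' t =
(∇v, φ(· - t h) h)`, which is at most `‖h‖ ‖∇v‖ ‖φ‖`. No approximation of `v` by smooth functions is
involved. -/
lemma lintegral_translate_sub_le (hb : Bornology.IsBounded Ω) (hU : IsOpen U)
    (v : H1 Ω) (h : EuclideanSpace ℝ (Fin d))
    (hseg : ∀ x ∈ U, ∀ t ∈ Icc (0 : ℝ) 1, x + t • h ∈ Ω) :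
    ∫⁻ x in U, ‖fn v (x + h) - fn v x‖ₑ ^ 2 ≤ ENNReal.ofReal ((‖h‖ * ‖grad v‖) ^ 2) := by
  have hU0 : U ⊆ Ω := fun x hx => by simpa using hseg x hx 0 (by simp)
  have hU1 : U ⊆ (fun x => x + h) ⁻¹' Ω := fun x hx => by simpa using hseg x hx 1 (by simp)
  have m0 : MemLp (fn v) 2 (volume.restrict U) :=
    (Lp.memLp (fn v)).mono_measure (Measure.restrict_mono_set volume hU0)
  have m1 : MemLp (fun x => fn v (x + h)) 2 (volume.restrict U) := by
    have := (Lp.memLp (fn v)).comp_measurePreserving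
      ((measurePreserving_add_right volume h).restrict_preimage_emb
        (Homeomorph.addRight h).measurableEmbedding Ω)
    exact this.mono_measure (Measure.restrict_mono_set volume hU1)
  have m : MemLp (fun x => fn v (x + h) - fn v x) 2 (volume.restrict U) := m1.sub m0
  have key : ∀ φ (hφ : IsTestFunction U φ),
      |inner ℝ (m.toLp _ : L2 U) hφ.toL2| ≤ (‖h‖ * ‖grad v‖) * ‖hφ.toL2‖ := by
    intro φ hφ
    set K : ℝ → ℝ := fun t => ∫ y in Ω, fn v y * φ (y - t • h) with hK
    have hinner : inner ℝ (m.toLp _ : L2 U) hφ.toL2 = K 1 - K 0 := by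
      have e1 : ∫ x in U, fn v (x + h) * φ x = K 1 := by
        rw [hφ.setIntegral_mul, hK]
        simp only [one_smul]
        rw [(hφ.translate h fun x hx => show x + h ∈ Ω from @hU1 x hx).setIntegral_mul, 
          ← integral_add_right_eq_self (fun y => fn v y * φ (y - h)) h]
        simp only [add_sub_cancel_right]
      have e0 : ∫ x in U, fn v x * φ x = K 0 := by
        rw [hφ.setIntegral_mul, hK]
        simp only [zero_smul, sub_zero]
        rw [(hφ.mono hU0).setIntegral_mul]
      rw [hφ.inner_toL2, ← e1, ← e0]
      refine Eq.trans ?_ (integral_sub (m1.integrable_mul hφ.memLp) (m0.integrable_mul hφ.memLp))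
      refine integral_congr_ae ?_
      filter_upwards [m.coeFn_toLp] with x hx
      simp only [hx, sub_mul]
    rw [hinner]
    refine norm_image_sub_le_of_norm_deriv_le_segment_01'
      (fun t _ => (hasDerivAt_integral_translate hb (fn v) hφ.contDiff
        hφ.hasCompactSupport h t).hasDerivWithinAt) fun t ht => ?_
    have hT := hφ.translate (t • h) fun x hx => hseg x hx t ⟨ht.1, ht.2.le⟩
    have hnorm : ‖hT.toL2‖ = ‖hφ.toL2‖ := by
      rw [← sq_eq_sq₀ (norm_nonneg _) (norm_nonneg _), hT.norm_toL2_sq, hφ.norm_toL2_sq]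
      exact integral_sub_right_eq_self (fun x => φ x ^ 2) (t • h)
    have hd : ∫ y in Ω, fn v y * -(fderiv ℝ φ (y - t • h) h) = inner ℝ (grad v) (hT.vecL2 h) := by
      have := isWeakGrad_iff.1 v.2 _ hT h
      change inner ℝ (fn v) _ = - inner ℝ (grad v) _ at this
      rw [← neg_eq_iff_eq_neg] at this
      rw [← this, hT.inner_derivL2, ← integral_neg]
      simp only [fderiv_comp_sub, mul_neg]
    rw [hd, ← hnorm]
    refine (norm_inner_le_norm (𝕜 := ℝ) _ _).trans ?_
    nlinarith [hT.norm_vecL2_le h, norm_nonneg (grad v)]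
  rw [lintegral_enorm_sq_eq m]
  refine ENNReal.ofReal_le_ofReal ?_
  rcases norm_le_of_forall_test hU _ _ key with h1 | h1
  · gcongr
  · rw [h1, norm_zero, zero_pow two_ne_zero]
    positivity

end Translation

/-! ### Local Poincaré inequalities -/

/-- Substitute `y = x + h` and exchange the integrals. For fixed `h` the translation estimate
applies on the set of `x ∈ U` with `x + h ∈ B`, and this set is empty unless `‖h‖ < 2R`. -/
lemma lintegral_lintegral_sub_le {R : ℝ} (hR : Ω ⊆ Metric.ball 0 R) (hU : IsOpen U) (hB : IsOpen B)
    (hseg : ∀ x ∈ U, ∀ y ∈ B, ∀ t ∈ Icc (0 : ℝ) 1, x + t • (y - x) ∈ Ω) (v : H1 Ω) :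
    ∫⁻ x in U, ∫⁻ y in B, ‖fn v y - fn v x‖ₑ ^ 2 ≤
      ENNReal.ofReal ((2 * R * ‖grad v‖) ^ 2) *
        volume (Metric.ball (0 : EuclideanSpace ℝ (Fin d)) (2 * R)) := by
  have hb : Bornology.IsBounded Ω := Metric.isBounded_ball.subset hR
  have hmeas : Measurable (fn v : EuclideanSpace ℝ (Fin d) → ℝ) :=
    (Lp.stronglyMeasurable (fn v)).measurable
  set k : EuclideanSpace ℝ (Fin d) → EuclideanSpace ℝ (Fin d) → ℝ≥0∞ := fun x h =>
    U.indicator 1 x * (B.indicator 1 (x + h) * ‖fn v (x + h) - fn v x‖ₑ ^ 2) with hk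
  have hkm : Measurable (Function.uncurry k) := by
    have m1 : Measurable fun p : EuclideanSpace ℝ (Fin d) × EuclideanSpace ℝ (Fin d) =>
        p.1 + p.2 := measurable_fst.add measurable_snd
    refine ((measurable_one.indicator hU.measurableSet).comp measurable_fst).mul
      (((measurable_one.indicator hB.measurableSet).comp m1).mul ?_)
    exact (((hmeas.comp m1).sub (hmeas.comp measurable_fst)).enorm).pow_const 2
  have h1 : ∫⁻ x in U, ∫⁻ y in B, ‖fn v y - fn v x‖ₑ ^ 2 = ∫⁻ x, ∫⁻ h, k x h := by
    rw [← lintegral_indicator hU.measurableSet]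
    refine lintegral_congr fun x => ?_
    by_cases hx : x ∈ U
    · simp only [hk, indicator_of_mem hx, Pi.one_apply, one_mul]
      rw [← lintegral_indicator hB.measurableSet,
        ← lintegral_add_left_eq_self _ x]
      refine lintegral_congr fun h => ?_
      by_cases hh : x + h ∈ B <;> simp [hh]
    · simp [hk, hx]
  rw [h1, lintegral_lintegral_swap hkm.aemeasurable]
  have h2 : ∀ h, ∫⁻ x, k x h ≤ (Metric.ball (0 : EuclideanSpace ℝ (Fin d)) (2 * R)).indicator
      (fun _ => ENNReal.ofReal ((2 * R * ‖grad v‖) ^ 2)) h := by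
    intro h
    set V : Set (EuclideanSpace ℝ (Fin d)) := U ∩ (fun x => x + h) ⁻¹' B with hV
    have hVo : IsOpen V := hU.inter (hB.preimage (continuous_id.add continuous_const))
    have hkV : ∫⁻ x, k x h = ∫⁻ x in V, ‖fn v (x + h) - fn v x‖ₑ ^ 2 := by
      rw [← lintegral_indicator hVo.measurableSet]
      refine lintegral_congr fun x => ?_
      by_cases hx : x ∈ U <;> by_cases hxh : x + h ∈ B <;> simp [hk, hV, hx, hxh]
    have hVseg : ∀ x ∈ V, ∀ t ∈ Icc (0 : ℝ) 1, x + t • h ∈ Ω := fun x hx t ht => by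
      simpa using hseg x hx.1 (x + h) hx.2 t ht
    rw [hkV]
    rcases V.eq_empty_or_nonempty with hVe | ⟨x, hx⟩
    · rw [hVe]
      simp
    · have a0 : x ∈ Ω := by simpa using hVseg x hx 0 (by simp)
      have a1 : x + h ∈ Ω := by simpa using hVseg x hx 1 (by simp)
      have hh : ‖h‖ < 2 * R := by
        have b0 := mem_ball_zero_iff.1 (hR a0)
        have b1 := mem_ball_zero_iff.1 (hR a1)
        have := norm_sub_le (x + h) x
        rw [add_sub_cancel_left] at this
        linarith
      rw [indicator_of_mem (mem_ball_zero_iff.2 hh)]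
      refine (lintegral_translate_sub_le hb hVo v h hVseg).trans (ENNReal.ofReal_le_ofReal ?_)
      gcongr
  refine (lintegral_mono h2).trans ?_
  rw [lintegral_indicator Metric.isOpen_ball.measurableSet, setLIntegral_const]

lemma exists_testFunction_integral_eq_one (hB : IsOpen B) (hne : B.Nonempty) :
    ∃ φ, IsTestFunction B φ ∧ ∫ x, φ x = 1 := by
  obtain ⟨c, hc⟩ := hne
  obtain ⟨r, hr, hrB⟩ := Metric.isOpen_iff.1 hB c hc
  let f : ContDiffBump c := ⟨r / 4, r / 2, by positivity, by linarith⟩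
  refine ⟨f.normed volume, ⟨f.contDiff_normed, f.hasCompactSupport_normed, ?_⟩, f.integral_normed⟩
  rw [f.tsupport_normed_eq]
  exact (Metric.closedBall_subset_ball (by change r / 2 < r; linarith)).trans hrB

/-- Poincaré's inequality on a set all of whose points see a common ball. -/
lemma exists_local_poincare (hb : Bornology.IsBounded Ω) (hU : IsOpen U) (hB : IsOpen B)
    (hne : B.Nonempty) (hBΩ : B ⊆ Ω)
    (hseg : ∀ x ∈ U, ∀ y ∈ B, ∀ t ∈ Icc (0 : ℝ) 1, x + t • (y - x) ∈ Ω) :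
    ∃ (W : H10 Ω) (C : ℝ), 0 ≤ C ∧ ∀ v : H1 Ω,
      ∫⁻ x in U, ‖fn v x‖ₑ ^ 2 ≤
        ENNReal.ofReal (C * (inner ℝ (fn v) (fn (W : H1 Ω)) ^ 2 + ‖grad v‖ ^ 2)) := by
  obtain ⟨R, hR⟩ := hb.subset_ball 0
  obtain ⟨w, hw, hw1⟩ := exists_testFunction_integral_eq_one hB hne
  have hUΩ : U ⊆ Ω := fun x hx => by
    obtain ⟨y, hy⟩ := hne
    simpa using hseg x hx y hy 0 (by simp)
  have hUt : volume U ≠ ⊤ := (hb.subset hUΩ).measure_lt_top.ne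
  have hfin : IsFiniteMeasure (volume.restrict B) := ⟨by
    rw [Measure.restrict_apply_univ]; exact (hb.subset hBΩ).measure_lt_top⟩
  set D := volume.real (Metric.ball (0 : EuclideanSpace ℝ (Fin d)) (2 * R)) with hD
  refine ⟨⟨_, (hw.mono hBΩ).toH1_mem_H10⟩,
    2 * volume.real U + 2 * ‖hw.toL2‖ ^ 2 * ((2 * R) ^ 2 * D), by positivity, fun v => ?_⟩
  set m : ℝ := inner ℝ (fn v) (hw.mono hBΩ).toL2 with hm
  have hmB : m = ∫ y in B, fn v y * w y := by
    rw [hm, IsTestFunction.inner_toL2, IsTestFunction.setIntegral_mul (hw.mono hBΩ),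
      hw.setIntegral_mul]
  have hvB : MemLp (fn v) 2 (volume.restrict B) :=
    (Lp.memLp (fn v)).mono_measure (Measure.restrict_mono_set volume hBΩ)
  -- Since `∫ w = 1`, one has `m - v(x) = ∫_B (v(y) - v(x)) w(y) dy`; Cauchy–Schwarz bounds its
  -- square by `‖w‖² ∫_B |v(y) - v(x)|² dy`.
  have hpt : ∀ x, ‖fn v x‖ₑ ^ 2 ≤ ENNReal.ofReal 2 * ENNReal.ofReal (m ^ 2) +
      ENNReal.ofReal 2 * ENNReal.ofReal (‖hw.toL2‖ ^ 2) * ∫⁻ y in B, ‖fn v y - fn v x‖ₑ ^ 2 := by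
    intro x
    have hF : MemLp (fun y => fn v y - fn v x) 2 (volume.restrict B) :=
      hvB.sub (memLp_const _)
    have hd : m - fn v x = inner ℝ (hF.toLp _ : L2 B) hw.toL2 := by
      have e1 : ∫ y in B, fn v x * w y = fn v x := by
        rw [hw.setIntegral_mul, integral_const_mul, hw1, mul_one]
      rw [hw.inner_toL2, hmB]
      refine (congrArg (fun z => (∫ y in B, fn v y * w y) - z) e1.symm).trans ?_
      refine (integral_sub (hvB.integrable_mul hw.memLp)
        (MemLp.integrable_mul (p := 2) (memLp_const (fn v x)) hw.memLp)).symm.trans ?_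
      refine integral_congr_ae ?_
      filter_upwards [hF.coeFn_toLp] with y hy
      simp only [hy, sub_mul, Pi.mul_apply]
    rw [lintegral_enorm_sq_eq hF, mul_assoc, ← ENNReal.ofReal_mul (by positivity),
      ← ENNReal.ofReal_mul (by positivity), ← ENNReal.ofReal_mul (by positivity),
      ← ENNReal.ofReal_add (by positivity) (by positivity), ← ofReal_norm,
      ← ENNReal.ofReal_pow (norm_nonneg _)]
    refine ENNReal.ofReal_le_ofReal ?_
    have h1 := real_inner_mul_inner_self_le (hF.toLp _ : L2 B) hw.toL2
    rw [← hd, real_inner_self_eq_norm_sq, real_inner_self_eq_norm_sq] at h1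
    rw [Real.norm_eq_abs, sq_abs]
    -- `2m² + 2(m - v(x))² - v(x)² = (2m - v(x))²`.
    nlinarith [sq_nonneg (2 * m - fn v x)]
  calc ∫⁻ x in U, ‖fn v x‖ₑ ^ 2
      ≤ ∫⁻ x in U, (ENNReal.ofReal 2 * ENNReal.ofReal (m ^ 2) +
          ENNReal.ofReal 2 * ENNReal.ofReal (‖hw.toL2‖ ^ 2) * ∫⁻ y in B, ‖fn v y - fn v x‖ₑ ^ 2) :=
        lintegral_mono hpt
    _ = ENNReal.ofReal 2 * ENNReal.ofReal (m ^ 2) * volume U +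
          ENNReal.ofReal 2 * ENNReal.ofReal (‖hw.toL2‖ ^ 2) *
          ∫⁻ x in U, ∫⁻ y in B, ‖fn v y - fn v x‖ₑ ^ 2 := by
        rw [lintegral_add_left measurable_const, setLIntegral_const, lintegral_const_mul']
        exact ENNReal.mul_ne_top ENNReal.ofReal_ne_top ENNReal.ofReal_ne_top
    _ ≤ ENNReal.ofReal 2 * ENNReal.ofReal (m ^ 2) * volume U +
          ENNReal.ofReal 2 * ENNReal.ofReal (‖hw.toL2‖ ^ 2) *
          (ENNReal.ofReal ((2 * R * ‖grad v‖) ^ 2) *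
            volume (Metric.ball (0 : EuclideanSpace ℝ (Fin d)) (2 * R))) := by
        gcongr
        exact lintegral_lintegral_sub_le hR hU hB hseg v
    _ = ENNReal.ofReal (2 * m ^ 2 * volume.real U + 2 * ‖hw.toL2‖ ^ 2 *
          ((2 * R * ‖grad v‖) ^ 2 * D)) := by
        rw [← ofReal_measureReal hUt, ← ofReal_measureReal Metric.isBounded_ball.measure_lt_top.ne,
          ← ENNReal.ofReal_mul (by positivity), ← ENNReal.ofReal_mul (by positivity),
          ← ENNReal.ofReal_mul (by positivity), ← ENNReal.ofReal_mul (by positivity),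
          ← ENNReal.ofReal_mul (by positivity),
          ← ENNReal.ofReal_add (by positivity) (by positivity)]
    _ ≤ _ := by
        refine ENNReal.ofReal_le_ofReal ?_
        have p1 : 0 ≤ volume.real U * ‖grad v‖ ^ 2 := by positivity
        have p2 : 0 ≤ ‖hw.toL2‖ ^ 2 * ((2 * R) ^ 2 * D) * m ^ 2 := by positivity
        change _ ≤ _ * (m ^ 2 + _)
        linarith

/-! ### Lipschitz domains -/

lemma norm_sub_inner_smul_le {E : Type} [NormedAddCommGroup E] [InnerProductSpace ℝ E] {ν : E}
    (hν : ‖ν‖ = 1) (c : E) : ‖c - inner ℝ ν c • ν‖ ≤ ‖c‖ := by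
  rw [← sq_le_sq₀ (norm_nonneg _) (norm_nonneg _), norm_sub_sq_real, real_inner_smul_right,
    norm_smul, hν, mul_one, Real.norm_eq_abs, sq_abs, real_inner_comm]
  nlinarith [sq_nonneg (inner ℝ ν c)]

/-- Near each point of its closure, a Lipschitz domain is star-shaped with respect to a ball. -/
lemma IsLipschitzDomain.exists_visible_ball (hΩ : IsLipschitzDomain Ω)
    {x : EuclideanSpace ℝ (Fin d)} (hx : x ∈ closure Ω) :
    ∃ ρ > 0, ∃ B : Set (EuclideanSpace ℝ (Fin d)), IsOpen B ∧ B.Nonempty ∧ B ⊆ Ω ∧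
      ∀ y ∈ Metric.ball x ρ ∩ Ω, ∀ z ∈ B, ∀ t ∈ Icc (0 : ℝ) 1, y + t • (z - y) ∈ Ω := by
  -- `B ⊆ Ω` is automatic: `x` is in the closure, so some `y ∈ Ω` lies in the ball, and `t = 1`
  -- gives each `z ∈ B`.
  suffices h : ∃ ρ > 0, ∃ B : Set (EuclideanSpace ℝ (Fin d)), IsOpen B ∧ B.Nonempty ∧
      ∀ y ∈ Metric.ball x ρ ∩ Ω, ∀ z ∈ B, ∀ t ∈ Icc (0 : ℝ) 1, y + t • (z - y) ∈ Ω by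
    obtain ⟨ρ, hρ, B, hB, hne, hseg⟩ := h
    refine ⟨ρ, hρ, B, hB, hne, fun z hz => ?_, hseg⟩
    obtain ⟨y, hyΩ, hy⟩ := Metric.mem_closure_iff.1 hx ρ hρ
    simpa using hseg y ⟨by rwa [Metric.mem_ball, dist_comm], hyΩ⟩ z hz 1 (by simp)
  by_cases hxΩ : x ∈ Ω
  · obtain ⟨ρ, hρ, hb⟩ := Metric.isOpen_iff.1 hΩ.isOpen x hxΩ
    refine ⟨ρ, hρ, Metric.ball x ρ, Metric.isOpen_ball, ⟨x, Metric.mem_ball_self hρ⟩, ?_⟩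
    exact fun y hy z hz t ht => hb ((convex_ball x ρ).add_smul_sub_mem hy.1 hz ht)
  · obtain ⟨ν, hν, K, γ, hγ, r, hr, hgraph⟩ := hΩ.lipschitz_boundary x
      ⟨hx, by rwa [hΩ.isOpen.interior_eq]⟩
    have hK : (0 : ℝ) ≤ K := K.2
    -- The ball `B` is centred at `x + (r/2) ν`, so `z - y = (r/2) ν + c` with `‖c‖ ≤ 2ρ`. Along the
    -- segment the height grows by at least `t (r/2 - 2ρ)`, while the graph rises by at most `2 K ρ
    -- t`. The choice `2ρ(K + 1) = r/2` balances the two.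
    set ρ := r / (4 * (K + 1)) with hρd
    have hρ : 0 < ρ := by positivity
    have hs : 2 * ρ * (K + 1) = r / 2 := by rw [hρd]; field_simp; ring
    have hρr : ρ ≤ r / 4 := by nlinarith
    refine ⟨ρ, hρ, Metric.ball (x + (r / 2) • ν) ρ, Metric.isOpen_ball,
      ⟨_, Metric.mem_ball_self hρ⟩, ?_⟩
    rintro y ⟨hy, hyΩ⟩ z hz t ht
    set c := (z - (x + (r / 2) • ν)) - (y - x) with hc
    have hcn : ‖c‖ ≤ 2 * ρ := by
      refine (norm_sub_le _ _).trans ?_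
      rw [mem_ball_iff_norm] at hy hz
      linarith
    have hzy : z - y = (r / 2) • ν + c := by rw [hc]; abel
    have hyr : y ∈ Metric.ball x r := Metric.ball_subset_ball (by linarith) hy
    have hzr : z ∈ Metric.ball x r := by
      rw [mem_ball_iff_norm] at hz ⊢
      have h1 : z - x = (z - (x + (r / 2) • ν)) + (r / 2) • ν := by abel
      rw [h1]
      refine (norm_add_le _ _).trans_lt ?_
      rw [norm_smul, hν, Real.norm_eq_abs, abs_of_pos (by positivity)]
      linarith
    rw [hgraph _ ((convex_ball x r).add_smul_sub_mem hyr hzr ht)]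
    have hy' := (hgraph y hyr).1 hyΩ
    set p := y + t • (z - y) with hp
    have hνν : inner ℝ ν ν = (1 : ℝ) := by rw [real_inner_self_eq_norm_sq, hν, one_pow]
    have hpν : inner ℝ ν p = inner ℝ ν y + t * (r / 2 + inner ℝ ν c) := by
      rw [hp, hzy, inner_add_right, real_inner_smul_right, inner_add_right, real_inner_smul_right,
        hνν, mul_one]
    have hperp : (p - inner ℝ ν p • ν) - (y - inner ℝ ν y • ν) =
        t • (c - inner ℝ ν c • ν) := by
      rw [hpν, hp, hzy]
      module
    have h1 := hγ.dist_le_mul (p - inner ℝ ν p • ν) (y - inner ℝ ν y • ν)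
    rw [dist_eq_norm, dist_eq_norm, hperp, norm_smul, Real.norm_eq_abs, Real.norm_eq_abs,
      abs_of_nonneg ht.1] at h1
    have h2 := (abs_le.1 h1).2
    have h3 := norm_sub_inner_smul_le hν c
    have h4 : -‖c‖ ≤ inner ℝ ν c := by
      have := abs_real_inner_le_norm ν c
      rw [hν, one_mul] at this
      exact (abs_le.1 this).1
    have h5 : K * (t * ‖c - inner ℝ ν c • ν‖) ≤ t * (K * (2 * ρ)) := by
      have := mul_le_mul_of_nonneg_left (h3.trans hcn) (mul_nonneg hK ht.1)
      linarith
    have h6 : t * (K * (2 * ρ)) ≤ t * (r / 2 + inner ℝ ν c) :=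
      mul_le_mul_of_nonneg_left (by linarith) ht.1
    linarith

/-- The boundary of a Lipschitz domain is a null set. -/
lemma IsLipschitzDomain.volume_frontier (hΩ : IsLipschitzDomain Ω) :
    volume (frontier Ω) = 0 := by
  refine measure_null_of_locally_null _ fun x hx => ?_
  obtain ⟨ν, hν, K, γ, hγ, r, hr, hgraph⟩ := hΩ.lipschitz_boundary x hx
  refine ⟨frontier Ω ∩ Metric.ball x r,
    inter_mem_nhdsWithin _ (Metric.ball_mem_nhds x hr), ?_⟩
  set G : Set (EuclideanSpace ℝ (Fin d)) := {y | γ (y - inner ℝ ν y • ν) = inner ℝ ν y} with hG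
  have hproj : Continuous fun y : EuclideanSpace ℝ (Fin d) => γ (y - inner ℝ ν y • ν) :=
    hγ.continuous.comp (by fun_prop)
  have hin : Continuous fun y : EuclideanSpace ℝ (Fin d) => inner ℝ ν y :=
    continuous_const.inner continuous_id
  have hνν : inner ℝ ν ν = (1 : ℝ) := by rw [real_inner_self_eq_norm_sq, hν, one_pow]
  -- Near `x` the frontier lies on the graph: a point strictly above it would be interior, and
  -- limits of points above it are not below it.
  have hsub : frontier Ω ∩ Metric.ball x r ⊆ G := by
    rintro y ⟨hy, hyr⟩
    have h1 : inner ℝ ν y ≤ γ (y - inner ℝ ν y • ν) := by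
      by_contra! hlt
      have : y ∈ Ω := (hgraph y hyr).2 hlt
      exact hy.2 (by rwa [hΩ.isOpen.interior_eq])
    refine le_antisymm ?_ h1
    have hcl : y ∈ closure (Ω ∩ Metric.ball x r) := by
      rw [inter_comm]
      exact Metric.isOpen_ball.inter_closure ⟨hyr, hy.1⟩
    exact closure_minimal (t := {y | γ (y - inner ℝ ν y • ν) ≤ inner ℝ ν y})
      (fun w hw => ((hgraph w hw.2).1 hw.1).le) (isClosed_le hproj hin) hcl
  refine measure_mono_null hsub ?_
  -- `G` meets each line in direction `ν` in at most one point, so its translates by the distinct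
  -- bounded vectors `ν/(n+1)` are disjoint, which forces measure zero.
  refine Measure.addHaar_eq_zero_of_disjoint_translates volume
    (fun n : ℕ => (1 / (n + 1 : ℝ)) • ν) ?_ ?_ (isClosed_eq hproj hin).measurableSet
  · refine (Metric.isBounded_closedBall (x := 0) (r := 1)).subset ?_
    rintro _ ⟨n, rfl⟩
    rw [mem_closedBall_zero_iff, norm_smul, hν, mul_one, Real.norm_eq_abs,
      abs_of_nonneg (by positivity), div_le_one (by positivity)]
    linarith [n.cast_nonneg (α := ℝ)]
  · intro m n hmn
    rw [Function.onFun, Set.disjoint_left]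
    simp only [singleton_add, mem_image]
    rintro _ ⟨y, hy, rfl⟩ ⟨z, hz, hzy⟩
    have hyz : z = y + (1 / (m + 1 : ℝ) - 1 / (n + 1 : ℝ)) • ν := by
      rw [sub_smul, ← add_sub_assoc, eq_sub_iff_add_eq, add_comm y, ← hzy, add_comm]
    set t := 1 / (m + 1 : ℝ) - 1 / (n + 1 : ℝ) with ht
    have hzν : inner ℝ ν z = inner ℝ ν y + t := by
      rw [hyz, inner_add_right, real_inner_smul_right, hνν, mul_one]
    have hperp : z - inner ℝ ν z • ν = y - inner ℝ ν y • ν := by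
      rw [hzν, hyz]
      module
    rw [mem_ofPred_eq, hperp, hy, hzν] at hz
    have ht0 : t = 0 := by linarith
    rw [ht, sub_eq_zero, one_div, one_div, inv_inj, add_left_inj, Nat.cast_inj] at ht0
    exact hmn ht0

/-! ### A global Poincaré inequality -/

/-- On a Lipschitz domain, the `L₂` norm is controlled by the norm of the gradient and finitely many
linear functionals `v ↦ (v, w)` with `w ∈ H¹₀`. -/
lemma IsLipschitzDomain.exists_poincare (hΩ : IsLipschitzDomain Ω) :
    ∃ (ι : Type) (_ : Fintype ι) (W : ι → H10 Ω) (C : ℝ), 0 ≤ C ∧ ∀ v : H1 Ω,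
      ‖fn v‖ ^ 2 ≤ C * (∑ i, inner ℝ (fn v) (fn (W i : H1 Ω)) ^ 2 + ‖grad v‖ ^ 2) := by
  have hcompact : IsCompact (closure Ω) := hΩ.isBounded.isCompact_closure
  have key : ∃ (ι : Type) (_ : Fintype ι) (W : ι → H10 Ω) (C : ℝ), 0 ≤ C ∧ ∀ v : H1 Ω,
      ∫⁻ x in closure Ω ∩ Ω, ‖fn v x‖ₑ ^ 2 ≤ ENNReal.ofReal
        (C * (∑ i, inner ℝ (fn v) (fn (W i : H1 Ω)) ^ 2 + ‖grad v‖ ^ 2)) := by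
    -- The inequality passes to unions by concatenating the lists of functionals. Each patch keeps
    -- its own functional, so mean values on different patches need not be compared.
    refine hcompact.induction_on (p := fun s => ∃ (ι : Type) (_ : Fintype ι) (W : ι → H10 Ω)
      (C : ℝ), 0 ≤ C ∧ ∀ v : H1 Ω, ∫⁻ x in s ∩ Ω, ‖fn v x‖ₑ ^ 2 ≤ ENNReal.ofReal
        (C * (∑ i, inner ℝ (fn v) (fn (W i : H1 Ω)) ^ 2 + ‖grad v‖ ^ 2))) ?_ ?_ ?_ ?_
    · exact ⟨Empty, inferInstance, fun i => i.elim, 0, le_rfl, fun v => by simp⟩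
    · rintro s t hst ⟨ι, hι, W, C, hC, h⟩
      exact ⟨ι, hι, W, C, hC, fun v =>
        (lintegral_mono_set (inter_subset_inter_left _ hst)).trans (h v)⟩
    · rintro s t ⟨ι, hι, W, C, hC, h⟩ ⟨ι', hι', W', C', hC', h'⟩
      refine ⟨ι ⊕ ι', inferInstance, Sum.elim W W', C + C', by positivity, fun v => ?_⟩
      rw [union_inter_distrib_right]
      refine (lintegral_union_le _ _ _).trans ((add_le_add (h v) (h' v)).trans ?_)
      have p1 : 0 ≤ ∑ i, inner ℝ (fn v) (fn (W i : H1 Ω)) ^ 2 :=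
        Finset.sum_nonneg fun i _ => sq_nonneg _
      have p2 : 0 ≤ ∑ i, inner ℝ (fn v) (fn (W' i : H1 Ω)) ^ 2 :=
        Finset.sum_nonneg fun i _ => sq_nonneg _
      rw [← ENNReal.ofReal_add (by positivity) (by positivity), Fintype.sum_sum_type]
      refine ENNReal.ofReal_le_ofReal ?_
      simp only [Sum.elim_inl, Sum.elim_inr]
      nlinarith [mul_nonneg hC p2, mul_nonneg hC' p1]
    · intro x hx
      obtain ⟨ρ, hρ, B, hB, hne, hBΩ, hseg⟩ := hΩ.exists_visible_ball hx
      obtain ⟨W, C, hC, h⟩ := exists_local_poincare hΩ.isBounded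
        (Metric.isOpen_ball.inter hΩ.isOpen) hB hne hBΩ hseg
      exact ⟨Metric.ball x ρ, mem_nhdsWithin_of_mem_nhds (Metric.ball_mem_nhds x hρ),
        Unit, inferInstance, fun _ => W, C, hC, fun v => by simpa using h v⟩
  obtain ⟨ι, hι, W, C, hC, h⟩ := key
  refine ⟨ι, hι, W, C, hC, fun v => ?_⟩
  have := h v
  rw [inter_eq_right.2 subset_closure, lintegral_enorm_sq_eq (Lp.memLp (fn v)), Lp.toLp_coeFn,
    ENNReal.ofReal_le_ofReal_iff] at this
  · exact this
  · exact mul_nonneg hC (add_nonneg (Finset.sum_nonneg fun i _ => sq_nonneg _) (sq_nonneg _))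

/-! ### A variant of the Lax–Milgram lemma -/

section LaxMilgram

variable {X : Type} [NormedAddCommGroup X] [InnerProductSpace ℝ X] [CompleteSpace X]

lemma surjective_of_coercive (T : X →L[ℝ] X) (h : ∀ x, ‖x‖ * ‖x‖ ≤ inner ℝ (T x) x) :
    Function.Surjective T := by
  have hco : IsCoercive ((innerSL ℝ).comp T : X →L[ℝ] X →L[ℝ] ℝ) :=
    ⟨1, one_pos, fun x => by simpa using h x⟩
  intro y
  refine ⟨hco.continuousLinearEquivOfBilin.symm y, ext_inner_right ℝ fun z => ?_⟩
  have := hco.continuousLinearEquivOfBilin_apply (hco.continuousLinearEquivOfBilin.symm y) z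
  rw [ContinuousLinearEquiv.apply_symm_apply] at this
  rw [this]
  rfl

/-- If `a` is nonnegative and `M a(x, x) + a(x, R x)` controls `‖x‖²`, then the variational problems
with the form `a` are well posed. -/
lemma wellPosed_of_coercive_add (a : X →L[ℝ] X →L[ℝ] ℝ) (R : X →L[ℝ] X) (M : ℝ) {c : ℝ}
    (hc : 0 < c) (ha : ∀ x, 0 ≤ a x x) (h : ∀ x, c * ‖x‖ ^ 2 ≤ M * a x x + a x (R x)) :
    (∀ F : X →L[ℝ] ℝ, ∃ x, a x = F) ∧ ∃ C, 0 ≤ C ∧ ∀ x, ‖x‖ ≤ C * ‖a x‖ := by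
  -- `T = M' + R` makes `a(x, T x)` coercive because `M' ≥ M` and `a(x, x) ≥ 0`. Since also `M' ≥
  -- ‖R‖ + 1`, `T` itself is coercive, hence onto, and testing with all `T z` is testing with
  -- everything.
  set M' := max M (‖R‖ + 1) with hM'
  set T : X →L[ℝ] X := M' • ContinuousLinearMap.id ℝ X + R with hT
  have hTx : ∀ x, T x = M' • x + R x := fun x => rfl
  have hTco : ∀ x, ‖x‖ * ‖x‖ ≤ inner ℝ (T x) x := by
    intro x
    rw [hTx, inner_add_left, real_inner_smul_left, real_inner_self_eq_norm_mul_norm]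
    have h1 := (abs_le.1 (abs_real_inner_le_norm (R x) x)).1
    have h2 := mul_le_mul_of_nonneg_right (R.le_opNorm x) (norm_nonneg x)
    have h3 : (‖R‖ + 1) * (‖x‖ * ‖x‖) ≤ M' * (‖x‖ * ‖x‖) :=
      mul_le_mul_of_nonneg_right (le_max_right _ _) (by positivity)
    linarith
  have haT : ∀ x, c * ‖x‖ ^ 2 ≤ a x (T x) := by
    intro x
    rw [hTx, map_add, map_smul, smul_eq_mul]
    have := mul_le_mul_of_nonneg_right (le_max_left M (‖R‖ + 1)) (ha x)
    linarith [h x]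
  constructor
  · intro F
    have hco : IsCoercive (a.bilinearComp (ContinuousLinearMap.id ℝ X) T : X →L[ℝ] X →L[ℝ] ℝ) :=
      ⟨c, hc, fun x => by
        rw [mul_assoc, ← sq]
        exact haT x⟩
    set y := (InnerProductSpace.toDual ℝ X).symm (F.comp T) with hy
    refine ⟨hco.continuousLinearEquivOfBilin.symm y, ?_⟩
    ext z
    obtain ⟨z, rfl⟩ := surjective_of_coercive T hTco z
    have := hco.continuousLinearEquivOfBilin_apply (hco.continuousLinearEquivOfBilin.symm y) z
    rw [ContinuousLinearEquiv.apply_symm_apply, hy, InnerProductSpace.toDual_symm_apply] at this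
    exact this.symm
  · refine ⟨‖T‖ / c, by positivity, fun x => ?_⟩
    rcases eq_or_ne x 0 with rfl | hx
    · simp
    · have hx' := norm_pos_iff.2 hx
      have h1 := (haT x).trans ((le_abs_self _).trans ((a x).le_opNorm (T x)))
      have h2 := mul_le_mul_of_nonneg_left (T.le_opNorm x) (norm_nonneg (a x))
      rw [div_mul_eq_mul_div, le_div_iff₀ hc]
      refine le_of_mul_le_mul_right ?_ hx'
      linarith

end LaxMilgram

/-! ### An abstract saddle point problem -/

section Saddle

variable {V V₀ H E : Type} [NormedAddCommGroup V] [InnerProductSpace ℝ V]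
  [NormedAddCommGroup V₀] [InnerProductSpace ℝ V₀]
  [NormedAddCommGroup H] [InnerProductSpace ℝ H] [NormedAddCommGroup E] [InnerProductSpace ℝ E]
  (F : V →L[ℝ] H) (G : V →L[ℝ] E) (j : V₀ →L[ℝ] V)

/-- `((r, p), (s, w)) ↦ (G r, G s) - (F p, F s) + (G p, G w) + (F r, F w)`. -/
def saddleForm : WithLp 2 (V × V₀) →L[ℝ] WithLp 2 (V × V₀) →L[ℝ] ℝ :=
  let f := WithLp.fstL 2 ℝ V V₀
  let s := j.comp (WithLp.sndL 2 ℝ V V₀)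
  (innerSL ℝ : E →L[ℝ] E →L[ℝ] ℝ).bilinearComp (G.comp f) (G.comp f)
    - (innerSL ℝ : H →L[ℝ] H →L[ℝ] ℝ).bilinearComp (F.comp s) (F.comp f)
    + (innerSL ℝ : E →L[ℝ] E →L[ℝ] ℝ).bilinearComp (G.comp s) (G.comp s)
    + (innerSL ℝ : H →L[ℝ] H →L[ℝ] ℝ).bilinearComp (F.comp f) (F.comp s)

lemma saddleForm_apply (x y : WithLp 2 (V × V₀)) : saddleForm F G j x y =
    inner ℝ (G x.fst) (G y.fst) - inner ℝ (F (j x.snd)) (F y.fst)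
      + inner ℝ (G (j x.snd)) (G (j y.snd)) + inner ℝ (F x.fst) (F (j y.snd)) := rfl

/-- The `F` terms couple the two components skew-symmetrically and cancel on the diagonal. -/
lemma saddleForm_self (x : WithLp 2 (V × V₀)) :
    saddleForm F G j x x = ‖G x.fst‖ ^ 2 + ‖G (j x.snd)‖ ^ 2 := by
  rw [saddleForm_apply, real_inner_self_eq_norm_sq, real_inner_self_eq_norm_sq,
    real_inner_comm (F x.fst)]
  ring

variable {ι : Type} [Fintype ι] (W : ι → V₀)

/-- `v ↦ ∑ i, (F v, F w_i) w_i`. -/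
def finiteRank : V →L[ℝ] V₀ :=
  ∑ i, ((innerSL ℝ (F (j (W i)))).comp F).smulRight (W i)

lemma finiteRank_apply (v : V) :
    finiteRank F j W v = ∑ i, inner ℝ (F (j (W i))) (F v) • W i := by
  simp [finiteRank]

/-- `(r, p) ↦ (-p, ∑ i, (F r, F w_i) w_i)`. -/
def stabiliser : WithLp 2 (V × V₀) →L[ℝ] WithLp 2 (V × V₀) :=
  ((WithLp.prodContinuousLinearEquiv 2 ℝ V V₀).symm : V × V₀ →L[ℝ] WithLp 2 (V × V₀)).comp
    ((-(j.comp (WithLp.sndL 2 ℝ V V₀))).prod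
      ((finiteRank F j W).comp (WithLp.fstL 2 ℝ V V₀)))

lemma stabiliser_fst (x : WithLp 2 (V × V₀)) : (stabiliser F j W x).fst = -(j x.snd) := rfl

lemma stabiliser_snd (x : WithLp 2 (V × V₀)) :
    (stabiliser F j W x).snd = finiteRank F j W x.fst := rfl

/-- The coupling terms yield `‖F p‖²` and `∑ (F r, F w_i)²`, the quantities missing from the
diagonal. The two remaining terms are of indefinite sign, but each has a `G` factor and can be
absorbed. -/
lemma saddleForm_stabiliser (x : WithLp 2 (V × V₀)) :
    saddleForm F G j x (stabiliser F j W x) =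
      - inner ℝ (G x.fst) (G (j x.snd)) + ‖F (j x.snd)‖ ^ 2
      + ∑ i, inner ℝ (F x.fst) (F (j (W i))) * inner ℝ (G (j x.snd)) (G (j (W i)))
      + ∑ i, inner ℝ (F x.fst) (F (j (W i))) ^ 2 := by
  rw [saddleForm_apply, stabiliser_fst, stabiliser_snd, finiteRank_apply]
  simp only [map_sum, map_smul, map_neg, inner_neg_right, inner_sum, real_inner_smul_right,
    real_inner_self_eq_norm_sq]
  have h : ∀ i, inner ℝ (F (j (W i))) (F x.fst) = inner ℝ (F x.fst) (F (j (W i))) :=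
    fun i => real_inner_comm _ _
  simp only [h, sq]
  ring

variable {F G j}

lemma saddleForm_coercive (hV : ∀ v, ‖v‖ ^ 2 = ‖F v‖ ^ 2 + ‖G v‖ ^ 2) (hj : ∀ p, ‖j p‖ = ‖p‖)
    {C : ℝ} (hC : 0 ≤ C)
    (h : ∀ v, ‖F v‖ ^ 2 ≤ C * (∑ i, inner ℝ (F v) (F (j (W i))) ^ 2 + ‖G v‖ ^ 2)) :
    ∃ M c : ℝ, 0 < c ∧ ∀ x : WithLp 2 (V × V₀),
      c * ‖x‖ ^ 2 ≤ M * saddleForm F G j x x + saddleForm F G j x (stabiliser F j W x) := by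
  set K := ∑ i, ‖G (j (W i))‖ ^ 2 with hK
  have hK0 : 0 ≤ K := Finset.sum_nonneg fun _ _ => sq_nonneg _
  -- By Young's inequality the indefinite terms cost at most `S/2` and `(1 + K)/2` times the
  -- diagonal; `3 + K` copies of the diagonal leave at least `S/2 + ‖G r‖² + ‖G p‖² + ‖F p‖²`. The
  -- hypothesis bounds `‖F r‖²` by `C (S + ‖G r‖²)`, which fixes the second constant.
  refine ⟨3 + K, 1 / (2 * (C + 1)), by positivity, fun x => ?_⟩
  rw [saddleForm_self, saddleForm_stabiliser]
  set S := ∑ i, inner ℝ (F x.fst) (F (j (W i))) ^ 2 with hS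
  have hS0 : 0 ≤ S := Finset.sum_nonneg fun _ _ => sq_nonneg _
  have hx : ‖x‖ ^ 2 = ‖F x.fst‖ ^ 2 + ‖G x.fst‖ ^ 2 +
      (‖F (j x.snd)‖ ^ 2 + ‖G (j x.snd)‖ ^ 2) := by
    rw [WithLp.prod_norm_sq_eq_of_L2, ← hV, ← hV, hj]
  have h3 := h x.fst
  rw [← hS] at h3
  have h1 : -(‖G x.fst‖ * ‖G (j x.snd)‖) ≤ - inner ℝ (G x.fst) (G (j x.snd)) :=
    neg_le_neg (real_inner_le_norm _ _)
  have h2 : -(S / 2 + K / 2 * ‖G (j x.snd)‖ ^ 2) ≤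
      ∑ i, inner ℝ (F x.fst) (F (j (W i))) * inner ℝ (G (j x.snd)) (G (j (W i))) := by
    rw [hS, hK, Finset.sum_div, Finset.sum_div, Finset.sum_mul, ← Finset.sum_add_distrib,
      ← Finset.sum_neg_distrib]
    refine Finset.sum_le_sum fun i _ => ?_
    have e1 := abs_le.1 (abs_real_inner_le_norm (G (j x.snd)) (G (j (W i))))
    have e2 := sq_le_sq' e1.1 e1.2
    nlinarith [sq_nonneg (inner ℝ (F x.fst) (F (j (W i))) + inner ℝ (G (j x.snd)) (G (j (W i))))]
  generalize ‖G x.fst‖ = A at *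
  generalize ‖G (j x.snd)‖ = B at *
  generalize ‖F (j x.snd)‖ = P at *
  have h4 : A * B ≤ A ^ 2 / 2 + B ^ 2 / 2 := by nlinarith [sq_nonneg (A - B)]
  have h5 : 1 / (2 * (C + 1)) * ‖x‖ ^ 2 ≤ S / 2 + A ^ 2 + B ^ 2 + P ^ 2 := by
    rw [one_div_mul_eq_div, div_le_iff₀ (by positivity), hx]
    nlinarith [mul_nonneg hC hS0, mul_nonneg hC (sq_nonneg A), sq_nonneg A, sq_nonneg B,
      sq_nonneg P, mul_nonneg hC (sq_nonneg B), mul_nonneg hC (sq_nonneg P)]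
  nlinarith [sq_nonneg A, sq_nonneg B, mul_nonneg hK0 (sq_nonneg A), mul_nonneg hK0 (sq_nonneg B)]

variable [CompleteSpace V] [CompleteSpace V₀]

/-- The two equations are the form tested with `(s, 0)` and `(0, w)`. The right-hand side `s ↦ (f, G
s)` has norm at most `‖f‖` because `‖G s‖ ≤ ‖s‖`. -/
lemma wellPosed_saddle (j : V₀ →ₗᵢ[ℝ] V) (hV : ∀ v, ‖v‖ ^ 2 = ‖F v‖ ^ 2 + ‖G v‖ ^ 2)
    {C₀ : ℝ} (hC₀ : 0 ≤ C₀)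
    (h : ∀ v, ‖F v‖ ^ 2 ≤ C₀ * (∑ i, inner ℝ (F v) (F (j (W i))) ^ 2 + ‖G v‖ ^ 2)) :
    ∃ C : ℝ, 0 ≤ C ∧
      (∀ f : E, ∃ r p, (∀ s, inner ℝ (F s) (F (j p)) + inner ℝ (G s) (f - G r) = 0) ∧
        ∀ w, inner ℝ (F (j w)) (F r) + inner ℝ (G (j w)) (G (j p)) = 0) ∧
      ∀ f r p, (∀ s, inner ℝ (F s) (F (j p)) + inner ℝ (G s) (f - G r) = 0) →
        (∀ w, inner ℝ (F (j w)) (F r) + inner ℝ (G (j w)) (G (j p)) = 0) →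
        ‖r‖ ≤ C * ‖f‖ ∧ ‖p‖ ≤ C * ‖f‖ := by
  obtain ⟨M, c, hc, hco⟩ := saddleForm_coercive (j := j.toContinuousLinearMap) W hV j.norm_map
    hC₀ h
  obtain ⟨hex, C, hC, hbd⟩ := wellPosed_of_coercive_add
    (saddleForm F G j.toContinuousLinearMap) (stabiliser F j.toContinuousLinearMap W) M hc
    (fun x => by rw [saddleForm_self]; positivity) hco
  have hG : ∀ v, ‖G v‖ ≤ ‖v‖ := fun v => by
    rw [← sq_le_sq₀ (norm_nonneg _) (norm_nonneg _), hV]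
    exact le_add_of_nonneg_left (sq_nonneg _)
  refine ⟨C, hC, fun f => ?_, fun f r p h1 h2 => ?_⟩
  · obtain ⟨x, hx⟩ := hex ((innerSL ℝ f).comp (G.comp (WithLp.fstL 2 ℝ V V₀)))
    have hxy : ∀ s w, inner ℝ (G x.fst) (G s) - inner ℝ (F (j x.snd)) (F s)
        + inner ℝ (G (j x.snd)) (G (j w)) + inner ℝ (F x.fst) (F (j w)) = inner ℝ f (G s) :=
      fun s w => DFunLike.congr_fun hx (WithLp.toLp 2 (s, w))
    refine ⟨x.fst, x.snd, fun s => ?_, fun w => ?_⟩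
    · have := hxy s 0
      simp only [map_zero, inner_zero_right] at this
      rw [inner_sub_right, real_inner_comm (F (j x.snd)), real_inner_comm f,
        real_inner_comm (G x.fst)]
      linarith
    · have := hxy 0 w
      simp only [map_zero, inner_zero_right] at this
      rw [real_inner_comm (F x.fst), real_inner_comm (G (j x.snd))]
      linarith
  · have hF : ‖saddleForm F G j.toContinuousLinearMap (WithLp.toLp 2 (r, p))‖ ≤ ‖f‖ := by
      refine ContinuousLinearMap.opNorm_le_bound _ (norm_nonneg _) fun y => ?_
      have e1 := h1 y.fst
      have e2 := h2 y.snd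
      have e : saddleForm F G j.toContinuousLinearMap (WithLp.toLp 2 (r, p)) y =
          inner ℝ f (G y.fst) := by
        rw [inner_sub_right] at e1
        rw [saddleForm_apply]
        change inner ℝ (G r) (G y.fst) - inner ℝ (F (j p)) (F y.fst) +
          inner ℝ (G (j p)) (G (j y.snd)) + inner ℝ (F r) (F (j y.snd)) = _
        rw [real_inner_comm _ f, real_inner_comm _ (G r),
          real_inner_comm _ (F (j p)), real_inner_comm _ (G (j p)), real_inner_comm _ (F r)]
        linarith
      rw [e]
      exact (norm_inner_le_norm (𝕜 := ℝ) _ _).trans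
        (mul_le_mul_of_nonneg_left ((hG _).trans (WithLp.norm_fst_le _ y)) (norm_nonneg _))
    have hx := (hbd (WithLp.toLp 2 (r, p))).trans (mul_le_mul_of_nonneg_left hF hC)
    exact ⟨(WithLp.norm_fst_le _ (WithLp.toLp 2 (r, p))).trans hx,
      (WithLp.norm_snd_le _ (WithLp.toLp 2 (r, p))).trans hx⟩

lemma wellPosed_saddle_submodule (K : Submodule ℝ V) (hK : IsClosed (K : Set V))
    (hV : ∀ v, ‖v‖ ^ 2 = ‖F v‖ ^ 2 + ‖G v‖ ^ 2) (W : ι → V) (hW : ∀ i, W i ∈ K)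
    {C₀ : ℝ} (hC₀ : 0 ≤ C₀)
    (h : ∀ v, ‖F v‖ ^ 2 ≤ C₀ * (∑ i, inner ℝ (F v) (F (W i)) ^ 2 + ‖G v‖ ^ 2)) :
    ∃ C : ℝ, 0 ≤ C ∧
      (∀ f : E, ∃ r, ∃ p ∈ K, (∀ s, inner ℝ (F s) (F p) + inner ℝ (G s) (f - G r) = 0) ∧
        ∀ w ∈ K, inner ℝ (F w) (F r) + inner ℝ (G w) (G p) = 0) ∧
      ∀ (f : E), ∀ r, ∀ p ∈ K, (∀ s, inner ℝ (F s) (F p) + inner ℝ (G s) (f - G r) = 0) →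
        (∀ w ∈ K, inner ℝ (F w) (F r) + inner ℝ (G w) (G p) = 0) →
        ‖r‖ ≤ C * ‖f‖ ∧ ‖p‖ ≤ C * ‖f‖ := by
  have : CompleteSpace K := hK.completeSpace_coe
  obtain ⟨C, hC, hex, hbd⟩ := wellPosed_saddle (fun i => (⟨W i, hW i⟩ : K)) K.subtypeₗᵢ hV hC₀ h
  refine ⟨C, hC, fun f => ?_, fun f r p hp h1 h2 => ?_⟩
  · obtain ⟨r, p, h1, h2⟩ := hex f
    refine ⟨r, p, p.2, h1, fun w hw => ?_⟩
    exact h2 ⟨w, hw⟩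
  · exact hbd f r ⟨p, hp⟩ h1  fun w => h2 w w.2

end Saddle

/-! ### The reduced problem -/

/-- `fn` as a continuous linear map. -/
def fnL (ω : Set (EuclideanSpace ℝ (Fin d))) : H1 ω →L[ℝ] L2 ω :=
  LinearMap.mkContinuous fn 1 fun v => by rw [one_mul]; exact norm_fn_le v

/-- `grad` as a continuous linear map. -/
def gradL (ω : Set (EuclideanSpace ℝ (Fin d))) : H1 ω →L[ℝ] L2v ω :=
  LinearMap.mkContinuous grad 1 fun v => by rw [one_mul]; exact norm_grad_le v

/-- `r = div ∇ div u` and `p = div u` solve the weak form of the boundary value problem. -/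
structure IsReducedSolution (f : L2v Ω) (r p : H1 Ω) : Prop where
  mem : p ∈ H10 Ω
  eq_left : ∀ s : H1 Ω, inner ℝ (fn s) (fn p) + inner ℝ (grad s) (f - grad r) = 0
  eq_right : ∀ w ∈ H10 Ω, inner ℝ (fn w) (fn r) + inner ℝ (grad w) (grad p) = 0

lemma IsReducedSolution.sub {f f' : L2v Ω} {r p r' p' : H1 Ω} (h : IsReducedSolution f r p)
    (h' : IsReducedSolution f' r' p') : IsReducedSolution (f - f') (r - r') (p - p') where
  mem := (H10 Ω).sub_mem h.mem h'.mem
  eq_left s := by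
    have := h.eq_left s
    have := h'.eq_left s
    rw [map_sub, map_sub, sub_sub_sub_comm, inner_sub_right, inner_sub_right (grad s)]
    linarith
  eq_right w hw := by
    have := h.eq_right w hw
    have := h'.eq_right w hw
    rw [map_sub, map_sub, inner_sub_right, inner_sub_right (grad w)]
    linarith

/-- Well-posedness of the reduced problem. -/
lemma IsLipschitzDomain.wellPosed_reduced (hΩ : IsLipschitzDomain Ω) :
    ∃ C : ℝ, 0 ≤ C ∧ (∀ f : L2v Ω, ∃ r p : H1 Ω, IsReducedSolution f r p) ∧
      ∀ (f : L2v Ω) (r p : H1 Ω), IsReducedSolution f r p → ‖r‖ ≤ C * ‖f‖ ∧ ‖p‖ ≤ C * ‖f‖ := by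
  obtain ⟨ι, _, W, C₀, hC₀, hW⟩ := hΩ.exists_poincare
  obtain ⟨C, hC, hex, hbd⟩ := wellPosed_saddle_submodule (V := H1 Ω) (F := fnL Ω) (G := gradL Ω)
    (H10 Ω) (Submodule.isClosed_topologicalClosure _) norm_sq_H1 (fun i => (W i : H1 Ω))
    (fun i => (W i).2) hC₀ hW
  refine ⟨C, hC, fun f => ?_, fun f r p h => ?_⟩
  · obtain ⟨r, p, hp, h1, h2⟩ := hex f
    exact ⟨r, p, hp, h1, h2⟩
  · exact hbd f r p h.mem h.eq_left h.eq_right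

/-! ### Integration over the elements of a mesh -/

/-- A point of `Ω` outside every element lies in the closure of one of them, hence on its boundary,
which is null. -/
lemma Mesh.iUnion_ae_eq (𝒯 : Mesh Ω) : (⋃ i, 𝒯.elem i) =ᵐ[volume] Ω := by
  refine ((iUnion_subset 𝒯.elem_subset).eventuallyLE).antisymm ?_
  rw [ae_le_set]
  have hsub : Ω \ ⋃ i, 𝒯.elem i ⊆ ⋃ i, frontier (𝒯.elem i) := by
    rintro x ⟨hx, hx'⟩
    have := subset_closure hx
    rw [𝒯.closure_eq] at this
    obtain ⟨i, hi⟩ := mem_iUnion.1 this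
    refine mem_iUnion.2 ⟨i, hi, fun h => hx' (mem_iUnion.2 ⟨i, interior_subset h⟩)⟩
  exact measure_mono_null hsub (measure_iUnion_null fun i => (𝒯.elem_lipschitz i).volume_frontier)

lemma Mesh.sum_inner_restr {F : Type} [NormedAddCommGroup F] [InnerProductSpace ℝ F]
    (𝒯 : Mesh Ω) (a b : Lp F 2 (volume.restrict Ω)) :
    ∑ i, inner ℝ (restr (𝒯.elem_subset i) a) (restr (𝒯.elem_subset i) b) = inner ℝ a b := by
  have hint : Integrable (fun x => inner ℝ (a x) (b x)) (volume.restrict Ω) :=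
    L2.integrable_inner a b
  have h : ∀ i, inner ℝ (restr (𝒯.elem_subset i) a) (restr (𝒯.elem_subset i) b) =
      ∫ x in 𝒯.elem i, inner ℝ (a x) (b x) := fun i => by
    rw [L2.inner_def]
    refine integral_congr_ae ?_
    filter_upwards [restr_coeFn (𝒯.elem_subset i) a, restr_coeFn (𝒯.elem_subset i) b]
      with x hx hx'
    rw [hx, hx']
  rw [L2.inner_def, ← setIntegral_congr_set 𝒯.iUnion_ae_eq, integral_iUnion_fintype]
  · exact Finset.sum_congr rfl fun i _ => h i
  · exact fun i => (𝒯.elem_lipschitz i).isOpen.measurableSet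
  · exact fun i j hij => 𝒯.elem_disjoint i j hij
  · exact fun i => hint.mono_measure (Measure.restrict_mono_set _ (𝒯.elem_subset i))

lemma globalTraceGrad_apply (𝒯 : Mesh Ω) (v : H1 Ω) (τ : BrokenHdiv 𝒯) :
    globalTraceGrad 𝒯 v τ = ∑ i, inner ℝ (restr (𝒯.elem_subset i) (fn v)) (div (τ i)) +
      ∑ i, inner ℝ (restr (𝒯.elem_subset i) (grad v)) (fld (τ i)) := by
  rw [← Finset.sum_add_distrib]
  exact skelTraceGrad_apply 𝒯 (toBrokenH1 𝒯 v) τ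

lemma globalTraceDiv_apply (𝒯 : Mesh Ω) (τ : Hdiv Ω) (v : BrokenH1 𝒯) :
    globalTraceDiv 𝒯 τ v = ∑ i, inner ℝ (restr (𝒯.elem_subset i) (div τ)) (fn (v i)) +
      ∑ i, inner ℝ (restr (𝒯.elem_subset i) (fld τ)) (grad (v i)) := by
  rw [← Finset.sum_add_distrib]
  refine (skelTraceGrad_apply 𝒯 v (toBrokenHdiv 𝒯 τ)).trans (Finset.sum_congr rfl fun i _ => ?_)
  rw [real_inner_comm, real_inner_comm (grad (v i))]
  rfl

/-- Against a conforming field the interelement contributions cancel and only the pairing on `∂Ω`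
remains. -/
lemma globalTraceGrad_toBroken (𝒯 : Mesh Ω) (v : H1 Ω) (τ : Hdiv Ω) :
    globalTraceGrad 𝒯 v (toBrokenHdiv 𝒯 τ) = traceGrad Ω v τ := by
  rw [globalTraceGrad_apply, traceGrad_apply, ← 𝒯.sum_inner_restr, ← 𝒯.sum_inner_restr]
  rfl

lemma globalTraceDiv_toBroken (𝒯 : Mesh Ω) (τ : Hdiv Ω) (v : H1 Ω) :
    globalTraceDiv 𝒯 τ (toBrokenH1 𝒯 v) = traceGrad Ω v τ :=
  globalTraceGrad_toBroken 𝒯 v τ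

lemma traceGrad_toHdiv {φ : EuclideanSpace ℝ (Fin d) → ℝ} (h : IsTestFunction Ω φ)
    (e : EuclideanSpace ℝ (Fin d)) (v : H1 Ω) : traceGrad Ω v (h.toHdiv e) = 0 := by
  have := isWeakGrad_iff.1 v.2 φ h e
  change inner ℝ (fn v) _ = - inner ℝ (grad v) _ at this
  rw [traceGrad_apply, h.fld_toHdiv, h.div_toHdiv, this, neg_add_cancel]

/-! ### The trial function of a solution of the reduced problem -/

namespace IsReducedSolution

variable {f : L2v Ω} {r p : H1 Ω}

/-- The solution `u = f - ∇r` of the boundary value problem, with its divergence `p`. -/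
def u (h : IsReducedSolution f r p) : Hdiv Ω :=
  ⟨WithLp.toLp 2 (f - grad r, fn p), isWeakDiv_of_forall_toH1 fun _ hφ => h.eq_left hφ.toH1⟩

/-- The field `∇p`, with its divergence `r`. -/
def gradDivU (h : IsReducedSolution f r p) : Hdiv Ω :=
  ⟨WithLp.toLp 2 (grad p, fn r),
    isWeakDiv_of_forall_toH1 fun _ hφ => h.eq_right hφ.toH1 hφ.toH1_mem_H10⟩

lemma traceDiv_u (h : IsReducedSolution f r p) : traceDiv Ω h.u = 0 := by
  ext s
  exact h.eq_left s

/-- The trial function with components `u`, `p`, `∇p`, `r` and their skeleton traces. -/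
def trial (h : IsReducedSolution f r p) (𝒯 : Mesh Ω) : Trial 𝒯 where
  u₁ := f - grad r
  u₂ := fn p
  u₃ := grad p
  u₄ := fn r
  uhat₁ := ⟨globalTraceDiv 𝒯 h.u, h.u, h.traceDiv_u, rfl⟩
  uhat₂ := ⟨globalTraceGrad 𝒯 p, p, h.mem, rfl⟩
  uhat₃ := ⟨globalTraceDiv 𝒯 h.gradDivU, h.gradDivU, rfl⟩
  uhat₄ := ⟨globalTraceGrad 𝒯 r, r, rfl⟩

/-- Each skeleton pairing is by definition a sum of volume terms. They cancel those of `b` except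
`(u + ∇r, v₁) = (f, v₁)`. -/
lemma trial_solvesUltraweak (h : IsReducedSolution f r p) (𝒯 : Mesh Ω) :
    SolvesUltraweak 𝒯 f (h.trial 𝒯) := by
  intro v
  have e1 : globalTraceDiv 𝒯 h.u v.v₄ =
      ∑ i, inner ℝ (restr (𝒯.elem_subset i) (fn p)) (fn (v.v₄ i)) +
      ∑ i, inner ℝ (restr (𝒯.elem_subset i) (f - grad r)) (grad (v.v₄ i)) :=
    globalTraceDiv_apply _ _ _
  have e2 := globalTraceGrad_apply 𝒯 p v.v₃
  have e3 : globalTraceDiv 𝒯 h.gradDivU v.v₂ =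
      ∑ i, inner ℝ (restr (𝒯.elem_subset i) (fn r)) (fn (v.v₂ i)) +
      ∑ i, inner ℝ (restr (𝒯.elem_subset i) (grad p)) (grad (v.v₂ i)) :=
    globalTraceDiv_apply _ _ _
  have e4 := globalTraceGrad_apply 𝒯 r v.v₁
  simp only [bform, Lform, trial, e1, e2, e3, e4, inner_add_right, inner_sub_right,
    Finset.sum_add_distrib, Finset.sum_sub_distrib, map_sub, inner_sub_left]
  ring

lemma solvesProblem (h : IsReducedSolution f r p) (hΩ : IsOpen Ω) :
    SolvesProblem Ω f (f - grad r) :=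
  ⟨h.u, p, h.gradDivU, r, rfl, rfl, rfl, rfl, add_sub_cancel _ _,
    (mem_H10_iff hΩ p).1 h.mem, h.traceDiv_u⟩

end IsReducedSolution

/-! ### Ultraweak solutions -/

section Ultraweak

variable {𝒯 : Mesh Ω} {f : L2v Ω} {u : Trial 𝒯}

lemma dual_brokenH1_zero (g : StrongDual ℝ (BrokenH1 𝒯)) : g 0 = 0 :=
  ContinuousLinearMap.map_zero g

lemma dual_brokenHdiv_zero (g : StrongDual ℝ (BrokenHdiv 𝒯)) : g 0 = 0 :=
  ContinuousLinearMap.map_zero g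

/-- With a single nonzero test component the equation isolates one skeleton unknown and expresses it
through the fields. -/
lemma SolvesUltraweak.test_first (h : SolvesUltraweak 𝒯 f u) (v : BrokenHdiv 𝒯) :
    (u.uhat₄ : StrongDual ℝ (BrokenHdiv 𝒯)) v =
      ∑ i, inner ℝ (restr (𝒯.elem_subset i) u.u₄) (div (v i)) +
      ∑ i, inner ℝ (restr (𝒯.elem_subset i) (f - u.u₁)) (fld (v i)) := by
  have := h ⟨v, 0, 0, 0⟩
  simp only [bform, Lform, PiLp.zero_apply, LinearMap.map_zero, dual_brokenH1_zero,
    dual_brokenHdiv_zero, sub_zero, zero_add, add_zero,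
    inner_zero_right, Finset.sum_const_zero] at this
  simp only [map_sub, inner_sub_left, Finset.sum_sub_distrib]
  linarith

lemma SolvesUltraweak.test_second (h : SolvesUltraweak 𝒯 f u) (v : BrokenH1 𝒯) :
    (u.uhat₃ : StrongDual ℝ (BrokenH1 𝒯)) v =
      ∑ i, inner ℝ (restr (𝒯.elem_subset i) u.u₄) (fn (v i)) +
      ∑ i, inner ℝ (restr (𝒯.elem_subset i) u.u₃) (grad (v i)) := by
  have := h ⟨0, v, 0, 0⟩
  simp only [bform, Lform, PiLp.zero_apply, LinearMap.map_zero, dual_brokenH1_zero,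
    dual_brokenHdiv_zero, sub_zero, zero_add, add_zero,
    inner_zero_right, Finset.sum_const_zero] at this
  linarith

lemma SolvesUltraweak.test_third (h : SolvesUltraweak 𝒯 f u) (v : BrokenHdiv 𝒯) :
    (u.uhat₂ : StrongDual ℝ (BrokenHdiv 𝒯)) v =
      ∑ i, inner ℝ (restr (𝒯.elem_subset i) u.u₂) (div (v i)) +
      ∑ i, inner ℝ (restr (𝒯.elem_subset i) u.u₃) (fld (v i)) := by
  have := h ⟨0, 0, v, 0⟩
  simp only [bform, Lform, PiLp.zero_apply, LinearMap.map_zero, dual_brokenH1_zero,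
    dual_brokenHdiv_zero, sub_zero, zero_add, add_zero,
    inner_zero_right, Finset.sum_const_zero] at this
  linarith

lemma SolvesUltraweak.test_fourth (h : SolvesUltraweak 𝒯 f u) (v : BrokenH1 𝒯) :
    (u.uhat₁ : StrongDual ℝ (BrokenH1 𝒯)) v =
      ∑ i, inner ℝ (restr (𝒯.elem_subset i) u.u₂) (fn (v i)) +
      ∑ i, inner ℝ (restr (𝒯.elem_subset i) u.u₁) (grad (v i)) := by
  have := h ⟨0, 0, 0, v⟩
  simp only [bform, Lform, PiLp.zero_apply, LinearMap.map_zero, dual_brokenH1_zero,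
    dual_brokenHdiv_zero, sub_zero, zero_sub, add_zero,
    inner_zero_right, inner_neg_right, Finset.sum_neg_distrib, Finset.sum_const_zero] at this
  linarith

lemma Mesh.sum_toBrokenHdiv (𝒯 : Mesh Ω) (a : L2 Ω) (b : L2v Ω) (τ : Hdiv Ω) :
    ∑ i, inner ℝ (restr (𝒯.elem_subset i) a) (div (toBrokenHdiv 𝒯 τ i)) +
      ∑ i, inner ℝ (restr (𝒯.elem_subset i) b) (fld (toBrokenHdiv 𝒯 τ i)) =
    inner ℝ a (div τ) + inner ℝ b (fld τ) := by
  rw [← 𝒯.sum_inner_restr a, ← 𝒯.sum_inner_restr b]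
  rfl

lemma Mesh.sum_toBrokenH1 (𝒯 : Mesh Ω) (a : L2 Ω) (b : L2v Ω) (v : H1 Ω) :
    ∑ i, inner ℝ (restr (𝒯.elem_subset i) a) (fn (toBrokenH1 𝒯 v i)) +
      ∑ i, inner ℝ (restr (𝒯.elem_subset i) b) (grad (toBrokenH1 𝒯 v i)) =
    inner ℝ (fn v) a + inner ℝ (grad v) b := by
  rw [real_inner_comm a, real_inner_comm b, ← 𝒯.sum_inner_restr a, ← 𝒯.sum_inner_restr b]
  rfl

/-- Every solution of the ultraweak formulation comes from a solution of the reduced problem. -/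
lemma SolvesUltraweak.exists_eq_trial (hΩ : IsOpen Ω) (h : SolvesUltraweak 𝒯 f u) :
    ∃ (r p : H1 Ω) (hrp : IsReducedSolution f r p), u = hrp.trial 𝒯 := by
  obtain ⟨w₀, hw₀, hw₀'⟩ := u.uhat₁.2
  obtain ⟨p₀, hp₀, hp₀'⟩ := u.uhat₂.2
  obtain ⟨q₀, hq₀⟩ := u.uhat₃.2
  obtain ⟨r₀, hr₀⟩ := u.uhat₄.2
  -- Conforming tests leave only boundary traces of the chosen extensions. Those of `p₀ ∈ H10` and
  -- `w₀ ∈ Hdiv0` vanish, so `k3` and `k4` also encode the boundary conditions.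
  have k1 : ∀ τ : Hdiv Ω, inner ℝ u.u₄ (div τ) + inner ℝ (f - u.u₁) (fld τ) =
      traceGrad Ω r₀ τ := fun τ => by
    rw [← 𝒯.sum_toBrokenHdiv, ← h.test_first, ← hr₀, globalTraceGrad_toBroken]
  have k2 : ∀ v : H1 Ω, inner ℝ (fn v) u.u₄ + inner ℝ (grad v) u.u₃ =
      traceGrad Ω v q₀ := fun v => by
    rw [← 𝒯.sum_toBrokenH1, ← h.test_second, ← hq₀, globalTraceDiv_toBroken]
  have k3 : ∀ τ : Hdiv Ω, inner ℝ u.u₂ (div τ) + inner ℝ u.u₃ (fld τ) = 0 := fun τ => by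
    rw [← 𝒯.sum_toBrokenHdiv, ← h.test_third, ← hp₀', globalTraceGrad_toBroken,
      (mem_H10_iff hΩ p₀).1 hp₀, zero_apply]
  have k4 : ∀ v : H1 Ω, inner ℝ (fn v) u.u₂ + inner ℝ (grad v) u.u₁ = 0 := fun v => by
    rw [← 𝒯.sum_toBrokenH1, ← h.test_fourth, ← hw₀', globalTraceDiv_toBroken]
    exact DFunLike.congr_fun hw₀ v
  -- Test functions annihilate the boundary terms, so the field unknowns are weak derivatives of one
  -- another. The resulting `r` need not be `r₀`; only their skeleton traces will coincide.
  let r : H1 Ω := ⟨WithLp.toLp 2 (u.u₄, f - u.u₁), isWeakGrad_of_forall_toHdiv fun φ hφ e => 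
    (k1 _).trans (traceGrad_toHdiv hφ e r₀)⟩
  let p : H1 Ω := ⟨WithLp.toLp 2 (u.u₂, u.u₃), isWeakGrad_of_forall_toHdiv fun φ hφ e => k3 _⟩
  let q : Hdiv Ω := ⟨WithLp.toLp 2 (u.u₃, u.u₄), isWeakDiv_of_forall_toH1 fun φ hφ => 
    (k2 _).trans (traceGrad_toH1 hφ q₀)⟩
  have hgr : f - grad r = u.u₁ := sub_sub_cancel f u.u₁
  have hp : p ∈ H10 Ω := (mem_H10_iff hΩ p).2 (by ext τ; exact k3 τ)
  have hrp : IsReducedSolution f r p :=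
    { mem := hp
      eq_left := fun s => by rw [hgr]; exact k4 s
      eq_right := fun w hw => DFunLike.congr_fun ((mem_H10_iff hΩ w).1 hw) q }
  refine ⟨r, p, hrp, Trial.ext hgr.symm rfl rfl rfl (Subtype.ext ?_) (Subtype.ext ?_)
    (Subtype.ext ?_) (Subtype.ext ?_)⟩
  · ext v
    rw [h.test_fourth]
    change _ = globalTraceDiv 𝒯 hrp.u v
    rw [globalTraceDiv_apply]
    change _ = ∑ i, inner ℝ (restr (𝒯.elem_subset i) u.u₂) (fn (v i)) +
      ∑ i, inner ℝ (restr (𝒯.elem_subset i) (f - grad r)) (grad (v i))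
    rw [hgr]
  · ext v
    rw [h.test_third]
    exact (globalTraceGrad_apply 𝒯 p v).symm
  · ext v
    rw [h.test_second]
    exact (globalTraceDiv_apply 𝒯 hrp.gradDivU v).symm
  · ext v
    rw [h.test_first]
    exact (globalTraceGrad_apply 𝒯 r v).symm

end Ultraweak

/-! ### Norm bounds -/

/-- Any extension bounds the infimum, so no mesh-dependent constant appears. Nonnegativity is needed
in order to square the bound. -/
lemma normHalf_globalTraceGrad (𝒯 : Mesh Ω) (v : H1 Ω) :
    0 ≤ normHalf 𝒯 (globalTraceGrad 𝒯 v) ∧ normHalf 𝒯 (globalTraceGrad 𝒯 v) ≤ ‖v‖ := by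
  have h : ∀ x ∈ (fun v : H1 Ω => ‖v‖) '' {w | globalTraceGrad 𝒯 w = globalTraceGrad 𝒯 v},
      0 ≤ x := by
    rintro _ ⟨w, -, rfl⟩
    exact norm_nonneg w
  exact ⟨Real.sInf_nonneg h, csInf_le ⟨0, h⟩ ⟨v, rfl, rfl⟩⟩

lemma normMinusHalf_globalTraceDiv (𝒯 : Mesh Ω) (τ : Hdiv Ω) :
    0 ≤ normMinusHalf 𝒯 (globalTraceDiv 𝒯 τ) ∧ normMinusHalf 𝒯 (globalTraceDiv 𝒯 τ) ≤ ‖τ‖ := by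
  have h : ∀ x ∈ (fun τ : Hdiv Ω => ‖τ‖) '' {σ | globalTraceDiv 𝒯 σ = globalTraceDiv 𝒯 τ},
      0 ≤ x := by
    rintro _ ⟨w, -, rfl⟩
    exact norm_nonneg w
  exact ⟨Real.sInf_nonneg h, csInf_le ⟨0, h⟩ ⟨τ, rfl, rfl⟩⟩

lemma norm_Hdiv_le (τ : Hdiv Ω) : ‖τ‖ ≤ ‖fld τ‖ + ‖div τ‖ := by
  have := norm_sq_Hdiv τ
  refine le_of_sq_le_sq ?_ (by positivity)
  nlinarith [norm_nonneg (fld τ), norm_nonneg (div τ)]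

lemma IsReducedSolution.norm_trial_le {f : L2v Ω} {r p : H1 Ω} (h : IsReducedSolution f r p)
    (𝒯 : Mesh Ω) {C : ℝ} (hC : 0 ≤ C) (hr : ‖r‖ ≤ C * ‖f‖) (hp : ‖p‖ ≤ C * ‖f‖) :
    (h.trial 𝒯).norm ≤ 3 * (1 + 2 * C) * ‖f‖ := by
  set N := (1 + 2 * C) * ‖f‖ with hN
  have hf := norm_nonneg f
  have hCf : 0 ≤ C * ‖f‖ := by positivity
  have b1 : ‖f - grad r‖ ≤ ‖f‖ + C * ‖f‖ :=
    (norm_sub_le _ _).trans (add_le_add le_rfl ((norm_grad_le r).trans hr))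
  have b2 : ‖fn p‖ ≤ C * ‖f‖ := (norm_fn_le p).trans hp
  have b3 : ‖grad p‖ ≤ C * ‖f‖ := (norm_grad_le p).trans hp
  have b4 : ‖fn r‖ ≤ C * ‖f‖ := (norm_fn_le r).trans hr
  have c1 : ‖h.u‖ ≤ N := (norm_Hdiv_le _).trans ((add_le_add b1 b2).trans (by linarith))
  have c3 : ‖h.gradDivU‖ ≤ N := (norm_Hdiv_le _).trans ((add_le_add b3 b4).trans (by linarith))
  obtain ⟨n1, m1⟩ := normMinusHalf_globalTraceDiv 𝒯 h.u
  obtain ⟨n2, m2⟩ := normHalf_globalTraceGrad 𝒯 p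
  obtain ⟨n3, m3⟩ := normMinusHalf_globalTraceDiv 𝒯 h.gradDivU
  obtain ⟨n4, m4⟩ := normHalf_globalTraceGrad 𝒯 r
  have s1 := pow_le_pow_left₀ (norm_nonneg _) (b1.trans (by linarith : _ ≤ N)) 2
  have s2 := pow_le_pow_left₀ (norm_nonneg _) (b2.trans (by linarith : _ ≤ N)) 2
  have s3 := pow_le_pow_left₀ (norm_nonneg _) (b3.trans (by linarith : _ ≤ N)) 2
  have s4 := pow_le_pow_left₀ (norm_nonneg _) (b4.trans (by linarith : _ ≤ N)) 2
  have t1 := pow_le_pow_left₀ n1 (m1.trans c1) 2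
  have t2 := pow_le_pow_left₀ n2 (m2.trans (hp.trans (by linarith : _ ≤ N))) 2
  have t3 := pow_le_pow_left₀ n3 (m3.trans c3) 2
  have t4 := pow_le_pow_left₀ n4 (m4.trans (hr.trans (by linarith : _ ≤ N))) 2
  have hN0 : 0 ≤ N := by positivity
  rw [mul_assoc, ← hN]
  refine Real.sqrt_le_iff.2 ⟨by positivity, ?_⟩
  change ‖f - grad r‖ ^ 2 + ‖fn p‖ ^ 2 + ‖grad p‖ ^ 2 + ‖fn r‖ ^ 2 +
    normMinusHalf 𝒯 (globalTraceDiv 𝒯 h.u) ^ 2 + normHalf 𝒯 (globalTraceGrad 𝒯 p) ^ 2 +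
    normMinusHalf 𝒯 (globalTraceDiv 𝒯 h.gradDivU) ^ 2 + normHalf 𝒯 (globalTraceGrad 𝒯 r) ^ 2 ≤ _
  -- Eight squares, each at most `N²`, and `8 ≤ 3²`.
  nlinarith [sq_nonneg N]

end GradDiv

end

theorem mainTheorem1 (d : ℕ) (hd : 2 ≤ d) (Ω : Set (EuclideanSpace ℝ (Fin d)))
    (hΩ : GradDiv.IsLipschitzDomain Ω) (hsc : SimplyConnectedSpace Ω) :
    ∃ C : ℝ, 0 < C ∧ ∀ (𝒯 : GradDiv.Mesh Ω) (f : GradDiv.L2v Ω),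
      (∃! u : GradDiv.Trial 𝒯, GradDiv.SolvesUltraweak 𝒯 f u) ∧
      ∀ u : GradDiv.Trial 𝒯, GradDiv.SolvesUltraweak 𝒯 f u →
        u.norm ≤ C * ‖f‖ ∧ GradDiv.SolvesProblem Ω f u.u₁ := by
  obtain ⟨C, hC, hex, hbd⟩ := hΩ.wellPosed_reduced
  refine ⟨3 * (1 + 2 * C), by positivity, fun 𝒯 f => ⟨?_, fun u hu => ?_⟩⟩
  · obtain ⟨r, p, h⟩ := hex f
    refine ⟨h.trial 𝒯, h.trial_solvesUltraweak 𝒯, fun u hu => ?_⟩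
    obtain ⟨r', p', h', rfl⟩ := hu.exists_eq_trial hΩ.isOpen
    -- The difference of two reduced solutions has data `f - f = 0`, so the stability bound forces
    -- it to vanish.
    have hb := hbd _ _ _ (h'.sub h)
    rw [sub_self, norm_zero, mul_zero, norm_le_zero_iff, norm_le_zero_iff, sub_eq_zero,
      sub_eq_zero] at hb
    obtain ⟨rfl, rfl⟩ := hb
    rfl
  · obtain ⟨r, p, h, rfl⟩ := hu.exists_eq_trial hΩ.isOpen
    obtain ⟨hr, hp⟩ := hbd f r p h
    exact ⟨h.norm_trial_le 𝒯 hC hr hp, h.solvesProblem hΩ.isOpen⟩
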